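/- For $\Lambda=(\lambda_0,\dots,\lambda_n)\in\mathbb C^{n+1}$ let $E_\Lambda=\{f\in C^\infty(\mathbb R,\mathbb C): (\tfrac{d}{dx}-\lambda_0)\cdots(\tfrac{d}{dx}-\lambda_n)f=0\}$. For $a\ne b$, the Bernstein basis of $E_\Lambda$ with respect to $a,b$ is the system $p_{\Lambda,0},\dots,p_{\Lambda,n}\in E_\Lambda$ such that $p_{\Lambda,k}$ has a zero of order exactly $k$ at $a$ and a zero of order exactly $n-k$ at $b$, normalized by $p_{\Lambda,k}^{(k)}(a)=1$. Let $n\ge 1$ and let $\lambda_0,\dots,\lambda_n$ be complex numbers with $\lambda_0,\lambda_1$ real and $\lambda_0<\lambda_1$. Suppose that $E_{(\lambda_0,\dots,\lambda_n)}$ is closed under complex conjugation and that $0<b-a<\pi/M_n$, where $M_n=\max\{|\operatorname{Im}\lambda_j|: j=0,\dots,n\}$ (and $\pi/0:=\infty$). Then the Bernstein bases of $E_{(\lambda_0,\dots,\lambda_n)}$, $E_{(\lambda_1,\dots,\lambda_n)}$ and $E_{(\lambda_0,\lambda_2,\dots,\lambda_n)}$ with respect to $a,b$ exist and are unique, and the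 following hold. Real numbers $t_0,\dots,t_n$ are well defined inductively by $t_0=a$ and $$e^{(\lambda_0-\lambda_1)(t_k-t_{k-1})}=\lim_{x\to b}\frac{p_{(\lambda_0,\lambda_2,\dots,\lambda_n),k-1}(x)}{p_{(\lambda_1,\dots,\lambda_n),k-1}(x)},\qquad k=1,\dots,n,$$ and they satisfy $a=t_0<t_1<\dots<t_n=b$. Put $\alpha_0=1$ and $$\alpha_k=e^{-\lambda_0(t_k-a)}(-1)^k\prod_{l=0}^{k-1}\lim_{x\to b}\frac{\frac{d}{dx}p_{(\lambda_0,\dots,\lambda_n),l}(x)}{p_{(\lambda_1,\dots,\lambda_n),l}(x)},\qquad k=1,\dots,n,$$ where the limits exist and are real. Then $\alpha_0,\dots,\alpha_n>0$, and the operator $B$ on $C[a,b]$ defined by $$Bf=\sum_{k=0}^n\alpha_k f(t_k)\,p_{(\lambda_0,\dots,\lambda_n),k}$$ fixes the functions $e^{\lambda_0x}$ and $e^{\lambda_1x}$. Moreover, the $t_k$ and $\alpha_k$ are unique: if real numbers $t_0',\dots,t_n'$ and $\alpha_0',\dots,\alpha_n'$ satisfy $\sum_{k=0}^n\alpha_k'e^{\lambda_i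 t_k'}p_{(\lambda_0,\dots,\lambda_n),k}(x)=e^{\lambda_ix}$ for all $x\in[a,b]$ and $i=0,1$, then $t_k'=t_k$ and $\alpha_k'=\alpha_k$ for all $k$. -/

import Mathlib

/-- The differential operator `(d/dx - Λ 0) ⋯ (d/dx - Λ (N-1))` applied to `f : ℝ → ℂ`. -/
noncomputable def expDiffOp {N : ℕ} (Λ : Fin N → ℂ) (f : ℝ → ℂ) : ℝ → ℂ :=
  (List.ofFn Λ).foldr (fun μ g x => deriv g x - μ * g x) f

/-- The space `E_Λ` of exponential polynomials: smooth complex-valued functions on the real line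
annihilated by the differential operator with eigenvalues `Λ`. -/
def expPoly {N : ℕ} (Λ : Fin N → ℂ) : Set (ℝ → ℂ) :=
  {f | ContDiff ℝ ((⊤ : ℕ∞) : WithTop ℕ∞) f ∧ ∀ x, expDiffOp Λ f x = 0}

/-- A set of complex-valued functions is closed under complex conjugation. -/
def ClosedUnderConj (U : Set (ℝ → ℂ)) : Prop :=
  ∀ f ∈ U, (fun x => (starRingEnd ℂ) (f x)) ∈ U

/-- `f` has a zero of order (exactly) `k` at `c`. -/
def HasZeroOfOrder (f : ℝ → ℂ) (k : ℕ) (c : ℝ) : Prop :=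
  (∀ j < k, iteratedDeriv j f c = 0) ∧ iteratedDeriv k f c ≠ 0

/-- `p 0, …, p n` is a Bernstein basis of `E_(Λ 0, …, Λ n)` for the points `a, b`: `p k` lies in
the space, has a zero of order `k` at `a` and one of order `n - k` at `b`, and is normalized by
`(p k)^(k) (a) = 1`. -/
def IsBernsteinBasis {n : ℕ} (Λ : Fin (n + 1) → ℂ) (a b : ℝ) (p : Fin (n + 1) → ℝ → ℂ) : Prop :=
  ∀ k : Fin (n + 1), p k ∈ expPoly Λ ∧ HasZeroOfOrder (p k) k a ∧
    HasZeroOfOrder (p k) (n - k) b ∧ iteratedDeriv k (p k) a = 1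

/-- The Bernstein basis of `E_Λ` for `a, b` (an arbitrary family if there is none). -/
noncomputable def bernsteinBasis {n : ℕ} (Λ : Fin (n + 1) → ℂ) (a b : ℝ) :
    Fin (n + 1) → ℝ → ℂ :=
  Classical.epsilon (IsBernsteinBasis Λ a b)

/-- The largest modulus of the imaginary parts of the eigenvalues. -/
noncomputable def maxAbsIm {n : ℕ} (Λ : Fin (n + 1) → ℂ) : ℝ :=
  Finset.univ.sup' Finset.univ_nonempty (fun j => |(Λ j).im|)

/-- The operator `f ↦ ∑ k, α k * f (t k) * p_{Λ,k}`. It uses only the values of `f` at the nodes,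
hence acts on `C[a,b]` when the nodes lie in `[a,b]`. -/
noncomputable def bernsteinOp {n : ℕ} (Λ : Fin (n + 1) → ℂ) (a b : ℝ) (t α : Fin (n + 1) → ℝ)
    (f : ℝ → ℂ) : ℝ → ℂ :=
  fun x => ∑ k, (α k : ℂ) * f (t k) * bernsteinBasis Λ a b k x

/-- The function `x ↦ e^{c x}` on the real line. -/
noncomputable def expFun (c : ℝ) : ℝ → ℂ := fun x => (Real.exp (c * x) : ℂ)

/-! Let `p` be the Bernstein basis of the full space and `q`, `r` those with λ₀, respectively λ₁,
removed. Up to the alternating sign, let P_k, Q_k, R_k > 0 be the leading derivatives of p_k, q_k,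
r_k at b. Comparing zeros at both endpoints gives (d/dx - λ₀) p_k = q_{k-1} - (P_k/Q_k) q_k
(`IsSmoothBernstein.recurrence`). Hence e^{λ₀x} has positive coefficients in the basis `p`: they
start at e^{λ₀a} and are multiplied by P_k/Q_k at each step (`IsSmoothBernstein.sum_eq_cexp`). The
same holds for λ₁ with R_k in place of Q_k. The operator fixes both exponentials exactly when α_k
e^{λ_i t_k} equals the k-th coefficient for i = 0, 1. These two equations have exactly one solution
(t_k, α_k), and dividing them gives e^{(λ₁-λ₀)(t_{k+1}-t_k)} = Q_k/R_k.

The nodes therefore increase because R_k < Q_k (`IsSmoothBernstein.end_lt`), which comes from a sign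
comparison in the space with both λ₀ and λ₁ removed. That the last node is b follows by evaluating
at b, where only the last basis function survives.

Everything rests on zero counting (`eq_zero_of_zeroCount`): on an interval of length less than
π/M_n, a nonzero real solution has fewer zeros than the order of the equation. The real
characteristic polynomial splits into linear and quadratic factors, and each factor is a Wronskian,
or an iterated one, with functions that do not vanish on [a, b]. Rolle's theorem then costs one zero
per order. This yields existence and uniqueness of the bases (`IsDisconjugate.eq_zero`) and the
signs at b (`IsDisconjugate.sign`). -/

/-! ### The differential algebra of smooth functions -/

/-- The algebra of smooth functions from the real line to `𝕜`. -/
def smoothFun (𝕜 : Type*) [RCLike 𝕜] : Subalgebra 𝕜 (ℝ → 𝕜) where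
  carrier := {f : ℝ → 𝕜 | ContDiff ℝ ((⊤ : ℕ∞) : WithTop ℕ∞) f}
  mul_mem' := fun {f g} (hf : ContDiff ℝ ((⊤ : ℕ∞) : WithTop ℕ∞) f)
    (hg : ContDiff ℝ ((⊤ : ℕ∞) : WithTop ℕ∞) g) => hf.mul hg
  add_mem' := fun {f g} (hf : ContDiff ℝ ((⊤ : ℕ∞) : WithTop ℕ∞) f)
    (hg : ContDiff ℝ ((⊤ : ℕ∞) : WithTop ℕ∞) g) => hf.add hg
  algebraMap_mem' := fun c => (contDiff_const : ContDiff ℝ ((⊤ : ℕ∞) : WithTop ℕ∞) fun _ : ℝ => c)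

namespace smoothFun

variable {𝕜 : Type*} [RCLike 𝕜]

theorem contDiff (f : smoothFun 𝕜) : ContDiff ℝ ((⊤ : ℕ∞) : WithTop ℕ∞) (f : ℝ → 𝕜) := f.2

theorem differentiable (f : smoothFun 𝕜) : Differentiable ℝ (f : ℝ → 𝕜) :=
  (contDiff f).differentiable (by simp)

theorem continuous (f : smoothFun 𝕜) : Continuous (f : ℝ → 𝕜) := (contDiff f).continuous

theorem ext_apply {f g : smoothFun 𝕜} (h : ∀ x, (f : ℝ → 𝕜) x = (g : ℝ → 𝕜) x) : f = g :=
  Subtype.ext (funext h)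

/-- Differentiation as an endomorphism of the space of smooth functions. -/
noncomputable def D : Module.End 𝕜 (smoothFun 𝕜) where
  toFun f := ⟨deriv (f : ℝ → 𝕜), by
    have h : ContDiff ℝ ((⊤ : ℕ∞) : WithTop ℕ∞) (f : ℝ → 𝕜) := f.2
    exact (contDiff_infty_iff_deriv.1 h).2⟩
  map_add' f g := ext_apply fun x => deriv_add ((differentiable f) x) ((differentiable g) x)
  map_smul' c f := ext_apply fun x => deriv_const_smul c ((differentiable f) x)

theorem coe_D (f : smoothFun 𝕜) : ((D f : smoothFun 𝕜) : ℝ → 𝕜) = deriv (f : ℝ → 𝕜) := rfl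

theorem hasDerivAt (f : smoothFun 𝕜) (x : ℝ) :
    HasDerivAt (f : ℝ → 𝕜) ((D f : smoothFun 𝕜).1 x) x :=
  ((differentiable f) x).hasDerivAt

theorem coe_D_pow (j : ℕ) (f : smoothFun 𝕜) :
    (((D ^ j) f : smoothFun 𝕜) : ℝ → 𝕜) = iteratedDeriv j (f : ℝ → 𝕜) := by
  induction j generalizing f with
  | zero => simp
  | succ j ih => rw [pow_succ, Module.End.mul_apply, ih, iteratedDeriv_succ', coe_D]

theorem D_mul (f g : smoothFun 𝕜) : D (f * g) = D f * g + f * D g :=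
  ext_apply fun x => deriv_mul ((differentiable f) x) ((differentiable g) x)

theorem D_pow_succ_apply (j : ℕ) (f : smoothFun 𝕜) : (D ^ (j + 1)) f = (D ^ j) (D f) := by
  rw [pow_succ, Module.End.mul_apply]

/-- `f` vanishes at `c` together with its derivatives of order less than `i`. -/
def VanishesTo (f : smoothFun 𝕜) (i : ℕ) (c : ℝ) : Prop :=
  ∀ j < i, ((D ^ j) f).1 c = 0

theorem vanishesTo_zero (f : smoothFun 𝕜) (c : ℝ) : VanishesTo f 0 c :=
  fun _ h => absurd h (Nat.not_lt_zero _)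

theorem VanishesTo.mono {f : smoothFun 𝕜} {i j : ℕ} {c : ℝ} (h : VanishesTo f i c) (hj : j ≤ i) :
    VanishesTo f j c :=
  fun l hl => h l (hl.trans_le hj)

theorem vanishesTo_succ_iff {f : smoothFun 𝕜} {i : ℕ} {c : ℝ} :
    VanishesTo f (i + 1) c ↔ f.1 c = 0 ∧ VanishesTo (D f) i c := by
  constructor
  · intro h
    exact ⟨h 0 (Nat.succ_pos _), fun j hj => by
      rw [← D_pow_succ_apply]; exact h _ (Nat.succ_lt_succ hj)⟩
  · rintro ⟨h0, h⟩ (_ | j) hj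
    · exact h0
    · rw [D_pow_succ_apply]; exact h _ (Nat.lt_of_succ_lt_succ hj)

theorem vanishesTo_succ_iff' {f : smoothFun 𝕜} {i : ℕ} {c : ℝ} :
    VanishesTo f (i + 1) c ↔ VanishesTo f i c ∧ ((D ^ i) f).1 c = 0 := by
  constructor
  · exact fun h => ⟨h.mono (Nat.le_succ _), h _ (Nat.lt_succ_self _)⟩
  · rintro ⟨h, h0⟩ j hj
    rcases Nat.lt_succ_iff_lt_or_eq.1 hj with hj | rfl
    exacts [h j hj, h0]

theorem VanishesTo.add {f g : smoothFun 𝕜} {i : ℕ} {c : ℝ} (hf : VanishesTo f i c)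
    (hg : VanishesTo g i c) : VanishesTo (f + g) i c := fun j hj => by
  rw [map_add]
  change ((D ^ j) f).1 c + ((D ^ j) g).1 c = 0
  rw [hf j hj, hg j hj, add_zero]

theorem VanishesTo.smul {f : smoothFun 𝕜} {i : ℕ} {c : ℝ} (r : 𝕜) (hf : VanishesTo f i c) :
    VanishesTo (r • f) i c := fun j hj => by
  rw [map_smul]
  change r • ((D ^ j) f).1 c = 0
  rw [hf j hj, smul_zero]

theorem VanishesTo.sub {f g : smoothFun 𝕜} {i : ℕ} {c : ℝ} (hf : VanishesTo f i c)
    (hg : VanishesTo g i c) : VanishesTo (f - g) i c := by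
  have := hf.add (hg.smul (-1))
  rwa [neg_one_smul, ← sub_eq_add_neg] at this

theorem VanishesTo.deriv {f : smoothFun 𝕜} {i : ℕ} {c : ℝ} (hf : VanishesTo f i c) :
    VanishesTo (D f) (i - 1) c := by
  rcases i with _ | i
  · exact vanishesTo_zero _ _
  · exact (vanishesTo_succ_iff.1 hf).2

theorem VanishesTo.mul_left {f : smoothFun 𝕜} {i : ℕ} {c : ℝ} (w : smoothFun 𝕜)
    (hf : VanishesTo f i c) : VanishesTo (w * f) i c := by
  induction i generalizing f w with
  | zero => exact vanishesTo_zero _ _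
  | succ i ih =>
    have h := vanishesTo_succ_iff.1 hf
    refine vanishesTo_succ_iff.2 ⟨?_, ?_⟩
    · change w.1 c * f.1 c = 0
      rw [h.1, mul_zero]
    · rw [D_mul]
      exact (ih _ (hf.mono (Nat.le_succ _))).add (ih _ h.2)

theorem VanishesTo.of_mul_left {f w : smoothFun 𝕜} {i : ℕ} {c : ℝ} (hw : w.1 c ≠ 0)
    (hf : VanishesTo (w * f) i c) : VanishesTo f i c := by
  induction i generalizing f with
  | zero => exact vanishesTo_zero _ _
  | succ i ih =>
    have h := vanishesTo_succ_iff.1 hf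
    have h0 : w.1 c * f.1 c = 0 := h.1
    refine vanishesTo_succ_iff.2 ⟨(mul_eq_zero.1 h0).resolve_left hw, ih ?_⟩
    have h1 := h.2.sub ((ih (hf.mono (Nat.le_succ _))).mul_left (D w))
    rwa [D_mul, add_sub_cancel_left] at h1

/-- Near a zero of order at least `j`, a smooth function is its leading Taylor monomial up to
lower order. -/
theorem VanishesTo.tendsto_div_pow {f : smoothFun 𝕜} {j : ℕ} {c : ℝ} (hf : VanishesTo f j c) :
    Filter.Tendsto (fun x => (((x - c) ^ j)⁻¹ : ℝ) • f.1 x) (nhdsWithin c {c}ᶜ)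
      (nhds (((j.factorial : ℝ)⁻¹) • ((D ^ j) f).1 c)) := by
  have h := taylor_tendsto (f := f.1) (x₀ := c) (n := j) convex_univ (Set.mem_univ c)
    (((contDiff f).of_le (by exact_mod_cast le_top)).contDiffOn)
  rw [nhdsWithin_univ] at h
  have h2 : ∀ x, taylorWithinEval f.1 j Set.univ c x
      = ((j.factorial : ℝ)⁻¹ * (x - c) ^ j) • ((D ^ j) f).1 c := by
    intro x
    rw [taylor_within_apply, Finset.sum_range_succ, Finset.sum_eq_zero, zero_add,
      iteratedDerivWithin_univ, coe_D_pow]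
    intro l hl
    rw [iteratedDerivWithin_univ, ← coe_D_pow, hf l (Finset.mem_range.1 hl), smul_zero]
  have h3 := (h.mono_left (nhdsWithin_le_nhds (s := {c}ᶜ))).add_const
    (((j.factorial : ℝ)⁻¹) • ((D ^ j) f).1 c)
  rw [zero_add] at h3
  refine h3.congr' ?_
  filter_upwards [self_mem_nhdsWithin] with x hx
  have hx' : (x - c) ^ j ≠ 0 := pow_ne_zero _ (sub_ne_zero.2 hx)
  rw [h2, smul_sub, smul_smul, mul_left_comm, inv_mul_cancel₀ hx', mul_one, sub_add_cancel]

/-- Divide numerator and denominator by (x - c)^j. Only the leading derivative of `g` has to be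
nonzero. This evaluates all limits in the definitions of nodes and weights. -/
theorem VanishesTo.tendsto_div {f g : smoothFun 𝕜} {j : ℕ} {c : ℝ} (hf : VanishesTo f j c)
    (hg : VanishesTo g j c) (hgj : ((D ^ j) g).1 c ≠ 0) :
    Filter.Tendsto (fun x => f.1 x / g.1 x) (nhdsWithin c {c}ᶜ)
      (nhds (((D ^ j) f).1 c / ((D ^ j) g).1 c)) := by
  have hj : ((j.factorial : ℝ)⁻¹) ≠ 0 := inv_ne_zero (by exact_mod_cast j.factorial_ne_zero)
  have h := hf.tendsto_div_pow.div hg.tendsto_div_pow (smul_ne_zero hj hgj)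
  have key : ∀ (r : ℝ) (u v : 𝕜), r ≠ 0 → (r • u) / (r • v) = u / v := by
    intro r u v hr
    rw [RCLike.real_smul_eq_coe_mul, RCLike.real_smul_eq_coe_mul,
      mul_div_mul_left _ _ (by exact_mod_cast hr)]
  rw [key _ _ _ hj] at h
  refine h.congr' ?_
  filter_upwards [self_mem_nhdsWithin] with x hx
  exact key _ _ _ (inv_ne_zero (pow_ne_zero _ (sub_ne_zero.2 hx)))

end smoothFun
/-! ### Counting zeros by Rolle's theorem -/

namespace smoothFun

/-- `f` has at least `c` zeros in `[a, b]`, where only the endpoints are counted with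
multiplicity. -/
def ZeroCount (a b : ℝ) (f : smoothFun ℝ) (c : ℕ) : Prop :=
  ∃ (i j : ℕ) (S : Finset ℝ), c ≤ i + j + S.card ∧ VanishesTo f i a ∧ VanishesTo f j b ∧
    ∀ x ∈ S, x ∈ Set.Ioo a b ∧ f.1 x = 0

/-- The Wronskian of two smooth functions. -/
noncomputable def wronskian (w f : smoothFun ℝ) : smoothFun ℝ := w * D f - D w * f

theorem wronskian_apply (w f : smoothFun ℝ) (x : ℝ) :
    (wronskian w f).1 x = w.1 x * (D f).1 x - (D w).1 x * f.1 x := rfl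

/-- The quotient rule: Rolle's theorem for f/w produces zeros of the Wronskian. -/
theorem hasDerivAt_div (w f : smoothFun ℝ) {x : ℝ} (hx : w.1 x ≠ 0) :
    HasDerivAt (fun y => f.1 y / w.1 y) ((wronskian w f).1 x / w.1 x ^ 2) x := by
  have := (hasDerivAt f x).div (hasDerivAt w x) hx
  convert! this using 1
  rw [wronskian_apply]
  ring

theorem exists_wronskian_eq_zero {w f : smoothFun ℝ} {x y : ℝ} (hxy : x < y)
    (hw : ∀ z ∈ Set.Icc x y, w.1 z ≠ 0) (hx : f.1 x = 0) (hy : f.1 y = 0) :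
    ∃ z ∈ Set.Ioo x y, (wronskian w f).1 z = 0 := by
  obtain ⟨z, hz, h⟩ := exists_hasDerivAt_eq_zero (f := fun y => f.1 y / w.1 y)
    (f' := fun x => (wronskian w f).1 x / w.1 x ^ 2) hxy
    (fun z hz => (hasDerivAt_div w f (hw z hz)).continuousAt.continuousWithinAt)
    (by simp [hx, hy])
    (fun z hz => hasDerivAt_div w f (hw z (Set.Ioo_subset_Icc_self hz)))
  refine ⟨z, hz, (div_eq_zero_iff.1 h).resolve_right ?_⟩
  exact pow_ne_zero _ (hw z (Set.Ioo_subset_Icc_self hz))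

theorem exists_finset_wronskian_eq_zero {w f : smoothFun ℝ} {a b : ℝ}
    (hw : ∀ z ∈ Set.Icc a b, w.1 z ≠ 0) (S : Finset ℝ) (hS : ∀ x ∈ S, x ∈ Set.Icc a b ∧ f.1 x = 0) :
    ∃ T : Finset ℝ, S.card ≤ T.card + 1 ∧
      ∀ x ∈ T, x ∈ Set.Ioo a b ∧ (wronskian w f).1 x = 0 := by
  rcases hk : S.card with _ | k
  · exact ⟨∅, by simp, by simp⟩
  let e := S.orderEmbOfFin hk
  have he : ∀ i, e i ∈ S := fun i => S.orderEmbOfFin_mem hk i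
  have hlt : ∀ i : Fin k, e i.castSucc < e i.succ := fun i => e.strictMono Fin.castSucc_lt_succ
  have hex : ∀ i : Fin k, ∃ z ∈ Set.Ioo (e i.castSucc) (e i.succ), (wronskian w f).1 z = 0 := by
    intro i
    refine exists_wronskian_eq_zero (hlt i) (fun z hz => hw z ?_) (hS _ (he _)).2 (hS _ (he _)).2
    exact ⟨(hS _ (he _)).1.1.trans hz.1, hz.2.trans (hS _ (he _)).1.2⟩
  choose z hz hz0 using hex
  have hmono : StrictMono z := by
    intro i j hij
    have h1 : e i.succ ≤ e j.castSucc := e.monotone (Fin.succ_le_castSucc_iff.2 hij)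
    exact ((hz i).2.trans_le h1).trans (hz j).1
  refine ⟨Finset.univ.image z, ?_, ?_⟩
  · rw [Finset.card_image_of_injective _ hmono.injective]
    simp
  · intro x hx
    obtain ⟨i, -, rfl⟩ := Finset.mem_image.1 hx
    exact ⟨⟨(hS _ (he _)).1.1.trans_lt (hz i).1, (hz i).2.trans_le (hS _ (he _)).1.2⟩, hz0 i⟩

theorem ZeroCount.exists_eq_zero {a b : ℝ} (hab : a < b) {f : smoothFun ℝ} {c : ℕ}
    (h : ZeroCount a b f (c + 1)) : ∃ x ∈ Set.Icc a b, f.1 x = 0 := by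
  obtain ⟨i, j, S, h1, hi, hj, hS⟩ := h
  rcases i with _ | i
  · rcases j with _ | j
    · obtain ⟨x, hx⟩ := Finset.card_pos.1 (show 0 < S.card by omega)
      exact ⟨x, Set.Ioo_subset_Icc_self (hS x hx).1, (hS x hx).2⟩
    · exact ⟨b, Set.right_mem_Icc.2 hab.le, (vanishesTo_succ_iff.1 hj).1⟩
  · exact ⟨a, Set.left_mem_Icc.2 hab.le, (vanishesTo_succ_iff.1 hi).1⟩

theorem VanishesTo.wronskian {f : smoothFun ℝ} {i : ℕ} {c : ℝ} (w : smoothFun ℝ)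
    (h : VanishesTo f i c) : VanishesTo (wronskian w f) (i - 1) c :=
  (h.deriv.mul_left w).sub ((h.mul_left _).mono (Nat.sub_le _ _))

/-- Each endpoint zero loses one multiplicity but also serves as an end of a Rolle interval, so only
one zero is lost in total. Rolle's zeros lie in the open interval, so they do not collide with the
endpoint multiplicities. -/
theorem ZeroCount.wronskian {a b : ℝ} (hab : a < b) {f w : smoothFun ℝ} {c : ℕ}
    (hw : ∀ z ∈ Set.Icc a b, w.1 z ≠ 0) (h : ZeroCount a b f (c + 1)) :
    ZeroCount a b (wronskian w f) c := by
  obtain ⟨i, j, S, h1, hi, hj, hS⟩ := h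
  have haS : a ∉ S := fun h => (hS a h).1.1.false
  have hbS : b ∉ S := fun h => (hS b h).1.2.false
  have hS' : ∀ x ∈ S, x ∈ Set.Icc a b ∧ f.1 x = 0 :=
    fun x hx => ⟨Set.Ioo_subset_Icc_self (hS x hx).1, (hS x hx).2⟩
  have ha : a ∈ Set.Icc a b := Set.left_mem_Icc.2 hab.le
  have hb : b ∈ Set.Icc a b := Set.right_mem_Icc.2 hab.le
  obtain ⟨R, hR, hRcard⟩ : ∃ R : Finset ℝ, (∀ x ∈ R, x ∈ Set.Icc a b ∧ f.1 x = 0) ∧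
      i + j + S.card ≤ (i - 1) + (j - 1) + R.card := by
    rcases i with _ | i
    · rcases j with _ | j
      · exact ⟨S, hS', by omega⟩
      · refine ⟨insert b S, ?_, ?_⟩
        · intro x hx
          rcases Finset.mem_insert.1 hx with rfl | hx
          exacts [⟨hb, (vanishesTo_succ_iff.1 hj).1⟩, hS' x hx]
        · rw [Finset.card_insert_of_notMem hbS]; omega
    · rcases j with _ | j
      · refine ⟨insert a S, ?_, ?_⟩
        · intro x hx
          rcases Finset.mem_insert.1 hx with rfl | hx
          exacts [⟨ha, (vanishesTo_succ_iff.1 hi).1⟩, hS' x hx]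
        · rw [Finset.card_insert_of_notMem haS]; omega
      · refine ⟨insert a (insert b S), ?_, ?_⟩
        · intro x hx
          rcases Finset.mem_insert.1 hx with rfl | hx
          · exact ⟨ha, (vanishesTo_succ_iff.1 hi).1⟩
          rcases Finset.mem_insert.1 hx with rfl | hx
          exacts [⟨hb, (vanishesTo_succ_iff.1 hj).1⟩, hS' x hx]
        · rw [Finset.card_insert_of_notMem (by simp [hab.ne, haS]),
            Finset.card_insert_of_notMem hbS]
          omega
  obtain ⟨T, hT, hT0⟩ := exists_finset_wronskian_eq_zero hw R hR
  exact ⟨i - 1, j - 1, T, by omega, hi.wronskian w, hj.wronskian w, hT0⟩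

theorem ZeroCount.of_mul_left {a b : ℝ} (hab : a < b) {f w : smoothFun ℝ} {c : ℕ}
    (hw : ∀ z ∈ Set.Icc a b, w.1 z ≠ 0) (h : ZeroCount a b (w * f) c) : ZeroCount a b f c := by
  obtain ⟨i, j, S, h1, hi, hj, hS⟩ := h
  refine ⟨i, j, S, h1, hi.of_mul_left (hw a (Set.left_mem_Icc.2 hab.le)),
    hj.of_mul_left (hw b (Set.right_mem_Icc.2 hab.le)), fun x hx => ⟨(hS x hx).1, ?_⟩⟩
  have h2 : w.1 x * f.1 x = 0 := (hS x hx).2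
  exact (mul_eq_zero.1 h2).resolve_left (hw x (Set.Ioo_subset_Icc_self (hS x hx).1))

/-- A vanishing Wronskian makes f/w constant, and one zero of `f` makes the constant 0. -/
theorem eq_zero_of_wronskian_eq_zero {a b : ℝ} (hab : a < b) {f w : smoothFun ℝ}
    (hw : ∀ z ∈ Set.Icc a b, w.1 z ≠ 0) (h : ∀ z ∈ Set.Icc a b, (wronskian w f).1 z = 0)
    {z : ℝ} (hz : z ∈ Set.Icc a b) (hfz : f.1 z = 0) : ∀ x ∈ Set.Icc a b, f.1 x = 0 := by
  have hd : ∀ x ∈ Set.Icc a b,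
      HasDerivWithinAt (fun y => f.1 y / w.1 y) 0 (Set.Icc a b) x := by
    intro x hx
    have := (hasDerivAt_div w f (hw x hx)).hasDerivWithinAt (s := Set.Icc a b)
    rwa [h x hx, zero_div] at this
  intro x hx
  have hc : f.1 x / w.1 x = f.1 z / w.1 z := by
    refine (convex_Icc a b).is_const_of_fderivWithin_eq_zero (𝕜 := ℝ)
      (f := fun y => f.1 y / w.1 y) (fun y hy => (hd y hy).differentiableWithinAt) ?_ hx hz
    intro y hy
    have h1 := (hd y hy).hasFDerivWithinAt
    rw [h1.fderivWithin (uniqueDiffOn_Icc hab y hy)]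
    ext
    simp
  rw [hfz, zero_div] at hc
  exact (div_eq_zero_iff.1 hc).resolve_right (hw x hx)

/-- The real exponential `x ↦ e^{r x}` as a smooth function. -/
noncomputable def rexp (r : ℝ) : smoothFun ℝ :=
  ⟨fun x => Real.exp (r * x),
    ((contDiff_const.mul contDiff_id).exp : ContDiff ℝ ((⊤ : ℕ∞) : WithTop ℕ∞) _)⟩

theorem rexp_ne_zero (r x : ℝ) : (rexp r).1 x ≠ 0 := (Real.exp_pos _).ne'

theorem D_rexp (r : ℝ) : D (rexp r) = r • rexp r := by
  refine ext_apply fun x => ?_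
  have h : HasDerivAt (fun x => Real.exp (r * x)) (Real.exp (r * x) * (r * 1)) x :=
    ((hasDerivAt_id x).const_mul r).exp
  change deriv (fun x => Real.exp (r * x)) x = r * Real.exp (r * x)
  rw [h.deriv]
  ring

theorem wronskian_rexp (r : ℝ) (f : smoothFun ℝ) :
    wronskian (rexp r) f = rexp r * (D f - r • f) := by
  rw [wronskian, D_rexp, mul_sub, smul_mul_assoc, mul_smul_comm]

/-- The smooth function `x ↦ e^{α x} cos (β (x - c))`. -/
noncomputable def expCos (α β c : ℝ) : smoothFun ℝ :=
  ⟨fun x => Real.exp (α * x) * Real.cos (β * (x - c)), by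
    have h1 : ContDiff ℝ ((⊤ : ℕ∞) : WithTop ℕ∞) fun x : ℝ => Real.exp (α * x) :=
      (contDiff_const.mul contDiff_id).exp
    have h2 : ContDiff ℝ ((⊤ : ℕ∞) : WithTop ℕ∞) fun x : ℝ => Real.cos (β * (x - c)) :=
      (contDiff_const.mul (contDiff_id.sub contDiff_const)).cos
    exact h1.mul h2⟩

theorem D_D_expCos (α β c : ℝ) :
    D (D (expCos α β c)) = (2 * α) • D (expCos α β c) - (α ^ 2 + β ^ 2) • expCos α β c := by
  have he : ∀ x, HasDerivAt (fun x => Real.exp (α * x)) (α * Real.exp (α * x)) x := by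
    intro x
    have h : HasDerivAt (fun x => Real.exp (α * x)) (Real.exp (α * x) * (α * 1)) x :=
      ((hasDerivAt_id x).const_mul α).exp
    convert! h using 1
    ring
  have hl : ∀ x, HasDerivAt (fun x => β * (x - c)) β x := by
    intro x
    have h := ((hasDerivAt_id x).sub_const c).const_mul β
    rwa [mul_one] at h
  have h1 : ∀ x, (D (expCos α β c)).1 x = α * Real.exp (α * x) * Real.cos (β * (x - c))
      - β * (Real.exp (α * x) * Real.sin (β * (x - c))) := by
    intro x
    have h := (he x).mul (hl x).cos
    change deriv ((fun x => Real.exp (α * x)) * fun x => Real.cos (β * (x - c))) x = _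
    rw [h.deriv]
    ring
  refine ext_apply fun x => ?_
  have h2 : HasDerivAt (D (expCos α β c)).1
      (α * (α * Real.exp (α * x) * Real.cos (β * (x - c))
        + Real.exp (α * x) * (-Real.sin (β * (x - c)) * β))
      - β * (α * Real.exp (α * x) * Real.sin (β * (x - c))
        + Real.exp (α * x) * (Real.cos (β * (x - c)) * β))) x := by
    have h := (((he x).mul (hl x).cos).const_mul α).sub (((he x).mul (hl x).sin).const_mul β)
    refine h.congr_of_eventuallyEq (Filter.Eventually.of_forall fun y => ?_)
    change _ = α * (Real.exp (α * y) * Real.cos (β * (y - c)))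
      - β * (Real.exp (α * y) * Real.sin (β * (y - c)))
    rw [h1, mul_assoc]
  change deriv (D (expCos α β c)).1 x = 2 * α * (D (expCos α β c)).1 x
    - (α ^ 2 + β ^ 2) * (Real.exp (α * x) * Real.cos (β * (x - c)))
  rw [h2.deriv, h1]
  ring

open Polynomial in
-- The function y = `expCos α β c` solves y'' = 2αy' - (α² + β²)y, so W = yf' - y'f satisfies W' -
-- 2αW = y(f'' - 2αf' + (α² + β²)f). The irreducible quadratic factor thus becomes two Wronskians.
theorem wronskian_wronskian_expCos (α β c : ℝ) (f : smoothFun ℝ) :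
    wronskian (rexp (2 * α)) (wronskian (expCos α β c) f) =
      rexp (2 * α) * (expCos α β c *
        aeval D (X ^ 2 - C (2 * α) * X + C (α ^ 2 + β ^ 2) : ℝ[X]) f) := by
  have h : aeval D (X ^ 2 - C (2 * α) * X + C (α ^ 2 + β ^ 2) : ℝ[X]) f
      = D (D f) - (2 * α) • D f + (α ^ 2 + β ^ 2) • f := by
    rw [map_add, map_sub, map_mul, map_pow, aeval_C, aeval_C, aeval_X, pow_two,
      Algebra.algebraMap_eq_smul_one, Algebra.algebraMap_eq_smul_one, smul_one_mul]
    rfl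
  rw [wronskian_rexp, h]
  congr 1
  rw [wronskian, map_sub, D_mul, D_mul, D_D_expCos]
  simp only [mul_sub, mul_add, sub_mul, smul_sub, smul_mul_assoc, mul_smul_comm]
  abel

open Polynomial in
/-- A solution on `[a, b]` of a homogeneous real linear differential equation with constant
coefficients vanishes on `[a, b]` if it has as many zeros there as the order of the equation, as
long as `b - a < π / |Im z|` for all characteristic roots `z`. -/
theorem eq_zero_of_zeroCount {a b : ℝ} (hab : a < b) (Q : ℝ[X]) (hQ : Q.Monic)
    (hroots : ∀ z : ℂ, aeval z Q = 0 → (b - a) * |z.im| < Real.pi) (f : smoothFun ℝ)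
    (hf : ∀ x ∈ Set.Icc a b, (aeval D Q f : smoothFun ℝ).1 x = 0)
    (hz : ZeroCount a b f Q.natDegree) : ∀ x ∈ Set.Icc a b, f.1 x = 0 := by
  induction hd : Q.natDegree using Nat.strong_induction_on generalizing Q f with
  | _ d ih =>
  by_cases hd0 : Q.natDegree = 0
  · rw [hQ.natDegree_eq_zero.1 hd0] at hf
    simpa using hf
  obtain ⟨z, hz0⟩ : ∃ z : ℂ, aeval z Q = 0 :=
    IsAlgClosed.exists_aeval_eq_zero _ Q
      (by rw [degree_eq_natDegree hQ.ne_zero]; exact_mod_cast hd0)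
  by_cases hzim : z.im = 0
  · have hr : Q.IsRoot z.re := by
      have hzr : z = ((z.re : ℝ) : ℂ) := Complex.ext rfl (by simp [hzim])
      rw [hzr] at hz0
      have h1 : ((Q.eval z.re : ℝ) : ℂ) = 0 := by
        rw [← hz0]
        exact (Polynomial.aeval_algebraMap_apply ℂ z.re Q).symm ▸ rfl
      exact_mod_cast h1
    obtain ⟨Q', hQ'⟩ := dvd_iff_isRoot.2 hr
    have hm1 : (X - C z.re : ℝ[X]).Monic := monic_X_sub_C _
    have hm' : Q'.Monic := by rw [hQ'] at hQ; exact hm1.of_mul_monic_left hQ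
    have hdeg : Q.natDegree = 1 + Q'.natDegree := by
      rw [hQ', hm1.natDegree_mul hm', natDegree_X_sub_C]
    set g : smoothFun ℝ := D f - z.re • f with hg
    have hgf : aeval D (X - C z.re : ℝ[X]) f = g := by
      simp [hg, Algebra.algebraMap_eq_smul_one]
    have hw := wronskian_rexp z.re f
    have hne : ∀ x ∈ Set.Icc a b, (rexp z.re).1 x ≠ 0 := fun x _ => rexp_ne_zero _ _
    rw [hdeg, Nat.add_comm] at hz
    have hzg : ZeroCount a b g Q'.natDegree := by
      refine ZeroCount.of_mul_left hab hne ?_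
      rw [← hw]
      exact hz.wronskian hab hne
    have hg0 : ∀ x ∈ Set.Icc a b, g.1 x = 0 := by
      refine ih Q'.natDegree (by omega) Q' hm' (fun u hu => hroots u ?_) g ?_ hzg rfl
      · rw [hQ', map_mul, hu, mul_zero]
      · rw [← hgf, ← Module.End.mul_apply, ← map_mul, mul_comm, ← hQ']
        exact hf
    obtain ⟨x₀, hx₀, hfx₀⟩ := hz.exists_eq_zero hab
    refine eq_zero_of_wronskian_eq_zero hab hne (fun x hx => ?_) hx₀ hfx₀
    rw [hw]
    change _ * g.1 x = 0
    rw [hg0 x hx, mul_zero]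
  · obtain ⟨Q', hQ'⟩ := Q.quadratic_dvd_of_aeval_eq_zero_im_ne_zero hz0 hzim
    have hnorm : ‖z‖ ^ 2 = z.re ^ 2 + z.im ^ 2 := by
      rw [Complex.sq_norm, Complex.normSq_apply]; ring
    rw [hnorm] at hQ'
    set Q₂ : ℝ[X] := X ^ 2 - C (2 * z.re) * X + C (z.re ^ 2 + z.im ^ 2) with hQ₂
    have hd2 : Q₂.natDegree = 2 := by rw [hQ₂]; compute_degree!
    have hm2 : Q₂.Monic := by rw [hQ₂]; monicity!
    have hm' : Q'.Monic := by rw [hQ'] at hQ; exact hm2.of_mul_monic_left hQ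
    have hdeg : Q.natDegree = 2 + Q'.natDegree := by
      rw [hQ', hm2.natDegree_mul hm', hd2]
    -- Centring at the midpoint keeps the argument of the cosine below (b - a)|Im z|/2 < π/2 in
    -- modulus, so `y` has no zero on [a, b].
    set y := expCos z.re z.im ((a + b) / 2) with hy
    have hyne : ∀ x ∈ Set.Icc a b, y.1 x ≠ 0 := by
      intro x hx
      have h1 := hroots z hz0
      have h2 : |z.im * (x - (a + b) / 2)| < Real.pi / 2 := by
        rw [abs_mul]
        have h3 : |x - (a + b) / 2| ≤ (b - a) / 2 := by
          rw [abs_le]; constructor <;> linarith [hx.1, hx.2]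
        nlinarith [abs_nonneg z.im]
      have h4 := abs_lt.1 h2
      exact mul_ne_zero (Real.exp_pos _).ne'
        (Real.cos_pos_of_mem_Ioo ⟨by linarith [h4.1], h4.2⟩).ne'
    have hne : ∀ x ∈ Set.Icc a b, (rexp (2 * z.re)).1 x ≠ 0 := fun x _ => rexp_ne_zero _ _
    have hww := wronskian_wronskian_expCos z.re z.im ((a + b) / 2) f
    rw [← hy, ← hQ₂] at hww
    set g := aeval D Q₂ f with hg
    have hz' : ZeroCount a b f (Q'.natDegree + 1 + 1) := by
      convert! hz using 1; omega
    have hzW := hz'.wronskian hab hyne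
    have hzg : ZeroCount a b g Q'.natDegree := by
      refine ZeroCount.of_mul_left hab hyne (ZeroCount.of_mul_left hab hne ?_)
      rw [← hww]
      exact hzW.wronskian hab hne
    have hg0 : ∀ x ∈ Set.Icc a b, g.1 x = 0 := by
      refine ih Q'.natDegree (by omega) Q' hm' (fun u hu => hroots u ?_) g ?_ hzg rfl
      · rw [hQ', map_mul, hu, mul_zero]
      · rw [hg, ← Module.End.mul_apply, ← map_mul, mul_comm, ← hQ']
        exact hf
    -- To return from g = 0 to f = 0, both integrations need a zero: `x₁` for the Wronskian of `y`
    -- and `f`, then `x₀` for `f` itself.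
    obtain ⟨x₁, hx₁, hWx₁⟩ := hzW.exists_eq_zero hab
    obtain ⟨x₀, hx₀, hfx₀⟩ := hz'.exists_eq_zero hab
    refine eq_zero_of_wronskian_eq_zero hab hyne ?_ hx₀ hfx₀
    refine eq_zero_of_wronskian_eq_zero hab hne (fun x hx => ?_) hx₁ hWx₁
    rw [hww]
    change _ * (_ * g.1 x) = 0
    rw [hg0 x hx, mul_zero, mul_zero]

end smoothFun
/-! ### Exponential polynomials -/

open Polynomial smoothFun

/-- The characteristic polynomial `∏ (X - Λ i)`. -/
noncomputable def charPoly {N : ℕ} (Λ : Fin N → ℂ) : ℂ[X] := ∏ i, (X - C (Λ i))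

theorem charPoly_succAbove {N : ℕ} (Λ : Fin (N + 1) → ℂ) (i : Fin (N + 1)) :
    charPoly Λ = (X - C (Λ i)) * charPoly (Fin.removeNth i Λ) :=
  Fin.prod_univ_succAbove _ i

theorem charPoly_monic {N : ℕ} (Λ : Fin N → ℂ) : (charPoly Λ).Monic :=
  monic_prod_of_monic _ _ fun i _ => monic_X_sub_C (Λ i)

theorem natDegree_charPoly {N : ℕ} (Λ : Fin N → ℂ) : (charPoly Λ).natDegree = N := by
  rw [charPoly, natDegree_prod_of_monic _ _ fun i _ => monic_X_sub_C (Λ i)]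
  simp

/-- The space of exponential polynomials as a subspace of the space of smooth functions. -/
noncomputable def expSpace {N : ℕ} (Λ : Fin N → ℂ) : Submodule ℂ (smoothFun ℂ) :=
  LinearMap.ker (aeval D (charPoly Λ))

theorem mem_expSpace {N : ℕ} {Λ : Fin N → ℂ} {f : smoothFun ℂ} :
    f ∈ expSpace Λ ↔ aeval D (charPoly Λ) f = 0 := LinearMap.mem_ker

theorem aeval_X_sub_C_D (μ : ℂ) (f : smoothFun ℂ) :
    aeval D (X - C μ : ℂ[X]) f = D f - μ • f := by
  rw [map_sub, aeval_C, aeval_X, Algebra.algebraMap_eq_smul_one]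
  rfl

theorem expDiffOp_eq {N : ℕ} (Λ : Fin N → ℂ) (f : smoothFun ℂ) :
    expDiffOp Λ f.1 = (aeval D (charPoly Λ) f).1 := by
  induction N with
  | zero => simp [expDiffOp, charPoly]
  | succ N ih =>
    have h1 : expDiffOp Λ f.1 = fun x => deriv (expDiffOp (Fin.removeNth 0 Λ) f.1) x
        - Λ 0 * expDiffOp (Fin.removeNth 0 Λ) f.1 x := by
      rw [expDiffOp, List.ofFn_succ, List.foldr_cons]
      rfl
    rw [h1, ih, charPoly_succAbove Λ 0, map_mul, Module.End.mul_apply, aeval_X_sub_C_D]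
    rfl

theorem coe_mem_expPoly {N : ℕ} {Λ : Fin N → ℂ} {f : smoothFun ℂ} :
    f.1 ∈ expPoly Λ ↔ f ∈ expSpace Λ := by
  rw [mem_expSpace]
  constructor
  · rintro ⟨-, h⟩
    exact ext_apply fun x => by rw [← expDiffOp_eq, h]; rfl
  · intro h
    exact ⟨contDiff f, fun x => by rw [expDiffOp_eq, h]; rfl⟩

theorem removeNth_mem_expSpace {N : ℕ} {Λ : Fin (N + 1) → ℂ} (i : Fin (N + 1)) {f : smoothFun ℂ}
    (hf : f ∈ expSpace (Fin.removeNth i Λ)) : f ∈ expSpace Λ := by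
  rw [mem_expSpace] at *
  rw [charPoly_succAbove Λ i, map_mul, Module.End.mul_apply, hf, map_zero]

theorem D_sub_smul_mem_expSpace_iff {N : ℕ} {Λ : Fin (N + 1) → ℂ} (i : Fin (N + 1))
    {f : smoothFun ℂ} : D f - Λ i • f ∈ expSpace (Fin.removeNth i Λ) ↔ f ∈ expSpace Λ := by
  rw [mem_expSpace, mem_expSpace, charPoly_succAbove Λ i, mul_comm, map_mul, Module.End.mul_apply,
    aeval_X_sub_C_D]

/-! ### Initial value problems -/

/-- The exponential `x ↦ e^{μ x}` as a smooth function. -/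
noncomputable def smoothFun.cexp (μ : ℂ) : smoothFun ℂ :=
  ⟨fun x => Complex.exp (μ * x), by
    have h : ContDiff ℝ ((⊤ : ℕ∞) : WithTop ℕ∞) fun x : ℝ => (x : ℂ) := Complex.ofRealCLM.contDiff
    exact (contDiff_const.mul h).cexp⟩

theorem smoothFun.D_cexp (μ : ℂ) : D (cexp μ) = μ • cexp μ := by
  refine ext_apply fun x => ?_
  have h : HasDerivAt (fun x : ℝ => Complex.exp (μ * x)) (Complex.exp (μ * x) * (μ * 1)) x :=
    ((Complex.ofRealCLM.hasDerivAt (x := x)).const_mul μ).cexp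
  change deriv (fun x : ℝ => Complex.exp (μ * x)) x = μ * Complex.exp (μ * x)
  rw [h.deriv]
  ring

theorem smoothFun.cexp_mul_cexp_neg (μ : ℂ) : cexp μ * cexp (-μ) = 1 := by
  refine ext_apply fun x => ?_
  change Complex.exp (μ * x) * Complex.exp (-μ * x) = 1
  rw [← Complex.exp_add]
  simp

theorem smoothFun.exists_D_eq (g : smoothFun ℂ) (a : ℝ) (c : ℂ) :
    ∃ f : smoothFun ℂ, D f = g ∧ f.1 a = c := by
  have hd : ∀ x, HasDerivAt (fun x => c + ∫ t in a..x, g.1 t) (g.1 x) x := fun x =>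
    ((intervalIntegral.integral_hasDerivAt_right
      ((smoothFun.continuous g).intervalIntegrable _ _)
      ((smoothFun.continuous g).stronglyMeasurableAtFilter _ _)
      (smoothFun.continuous g).continuousAt)).const_add c
  have hderiv : deriv (fun x => c + ∫ t in a..x, g.1 t) = g.1 := funext fun x => (hd x).deriv
  refine ⟨⟨fun x => c + ∫ t in a..x, g.1 t, ?_⟩, ext_apply fun x => (hd x).deriv, by simp⟩
  refine contDiff_infty_iff_deriv.2 ⟨fun x => (hd x).differentiableAt, ?_⟩
  rw [hderiv]
  exact contDiff g

/-- The integrating factor e^{-μx} reduces the equation to finding an antiderivative. -/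
theorem smoothFun.exists_D_sub_smul_eq (μ : ℂ) (g : smoothFun ℂ) (a : ℝ) (c : ℂ) :
    ∃ f : smoothFun ℂ, D f - μ • f = g ∧ f.1 a = c := by
  obtain ⟨h, hD, ha⟩ := exists_D_eq (cexp (-μ) * g) a ((cexp (-μ)).1 a * c)
  refine ⟨cexp μ * h, ?_, ?_⟩
  · rw [D_mul, D_cexp, hD, smul_mul_assoc, add_sub_cancel_left, ← mul_assoc, cexp_mul_cexp_neg,
      one_mul]
  · change (cexp μ).1 a * h.1 a = c
    have h1 : (cexp μ).1 a * (cexp (-μ)).1 a = 1 := congrFun (congrArg Subtype.val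
      (cexp_mul_cexp_neg μ)) a
    rw [ha, ← mul_assoc, h1, one_mul]

theorem smoothFun.eq_zero_of_D_eq_smul {μ : ℂ} {f : smoothFun ℂ} (h : D f - μ • f = 0) {a : ℝ}
    (ha : f.1 a = 0) : f = 0 := by
  have h1 : D (cexp (-μ) * f) = 0 := by
    rw [D_mul, D_cexp, sub_eq_zero.1 h, smul_mul_assoc, mul_smul_comm, neg_smul, neg_add_cancel]
  have h2 : ∀ x, (cexp (-μ) * f).1 x = (cexp (-μ) * f).1 a := fun x =>
    is_const_of_deriv_eq_zero (differentiable (cexp (-μ) * f))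
      (fun y => congrFun (congrArg Subtype.val h1) y) x a
  refine ext_apply fun x => ?_
  have h3 : (cexp (-μ)).1 x * f.1 x = (cexp (-μ)).1 a * f.1 a := h2 x
  rw [ha, mul_zero] at h3
  exact (mul_eq_zero.1 h3).resolve_left (Complex.exp_ne_zero _)

theorem exists_mem_expSpace_jet {N : ℕ} (Λ : Fin N → ℂ) (a : ℝ) (c : ℕ → ℂ) :
    ∃ f ∈ expSpace Λ, ∀ j < N, ((D ^ j) f).1 a = c j := by
  induction N generalizing c with
  | zero => exact ⟨0, zero_mem _, fun j hj => absurd hj (Nat.not_lt_zero _)⟩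
  | succ N ih =>
    -- This is the jet that f' - λf must have if `f` has jet `c`; solving the first-order equation
    -- recovers `f`.
    obtain ⟨g, hg, hjet⟩ := ih (Fin.removeNth 0 Λ) fun j => c (j + 1) - Λ 0 * c j
    obtain ⟨f, hf, hfa⟩ := exists_D_sub_smul_eq (Λ 0) g a (c 0)
    refine ⟨f, (D_sub_smul_mem_expSpace_iff 0).1 (by rwa [hf]), fun j => ?_⟩
    induction j with
    | zero => exact fun _ => hfa
    | succ j ihj =>
      intro hj
      have h1 := hjet j (by omega)
      rw [← hf, map_sub, map_smul, ← D_pow_succ_apply] at h1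
      have h2 : ((D ^ (j + 1)) f).1 a - Λ 0 * ((D ^ j) f).1 a = c (j + 1) - Λ 0 * c j := h1
      rw [ihj (by omega)] at h2
      exact sub_left_inj.1 h2

theorem eq_zero_of_vanishesTo {N : ℕ} {Λ : Fin N → ℂ} {f : smoothFun ℂ} (hf : f ∈ expSpace Λ)
    {a : ℝ} (ha : VanishesTo f N a) : f = 0 := by
  induction N generalizing f with
  | zero => simpa [mem_expSpace, charPoly] using hf
  | succ N ih =>
    refine eq_zero_of_D_eq_smul (ih ((D_sub_smul_mem_expSpace_iff 0).2 hf) ?_)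
      (vanishesTo_succ_iff.1 ha).1
    exact ha.deriv.sub ((ha.mono (Nat.le_succ _)).smul _)

/-- Exponential polynomials correspond to their initial data at a point. -/
theorem nonempty_expSpace_linearEquiv {N : ℕ} (Λ : Fin N → ℂ) :
    Nonempty (expSpace Λ ≃ₗ[ℂ] (Fin N → ℂ)) := by
  let J : expSpace Λ →ₗ[ℂ] (Fin N → ℂ) :=
    { toFun := fun f i => ((D ^ (i : ℕ)) f.1).1 0
      map_add' := fun f g => funext fun i => by
        rw [Submodule.coe_add, map_add]; rfl
      map_smul' := fun c f => funext fun i => by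
        rw [Submodule.coe_smul, map_smul]; rfl }
  have hinj : Function.Injective J := by
    intro f g hfg
    refine Subtype.ext (sub_eq_zero.1
      (eq_zero_of_vanishesTo (sub_mem f.2 g.2) (a := 0) fun j hj => ?_))
    rw [map_sub]
    exact sub_eq_zero.2 (congrFun hfg ⟨j, hj⟩)
  have hsurj : Function.Surjective J := by
    intro c
    obtain ⟨f, hf, hj⟩ := exists_mem_expSpace_jet Λ 0 fun j => if h : j < N then c ⟨j, h⟩ else 0
    refine ⟨⟨f, hf⟩, funext fun i => ?_⟩
    change ((D ^ (i : ℕ)) f).1 0 = c i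
    rw [hj i i.2, dif_pos i.2]
  exact ⟨LinearEquiv.ofBijective J ⟨hinj, hsurj⟩⟩

/-! ### Real and imaginary parts -/

/-- Composition of a smooth function with a real-linear functional. -/
noncomputable def smoothFun.compReal (φ : ℂ →L[ℝ] ℝ) (f : smoothFun ℂ) : smoothFun ℝ :=
  ⟨fun x => φ (f.1 x), φ.contDiff.comp (contDiff f)⟩

theorem smoothFun.D_compReal (φ : ℂ →L[ℝ] ℝ) (f : smoothFun ℂ) :
    D (compReal φ f) = compReal φ (D f) :=
  ext_apply fun x => (φ.hasFDerivAt.comp_hasDerivAt x (hasDerivAt f x)).deriv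

theorem smoothFun.D_pow_compReal (φ : ℂ →L[ℝ] ℝ) (j : ℕ) (f : smoothFun ℂ) :
    (D ^ j) (compReal φ f) = compReal φ ((D ^ j) f) := by
  induction j generalizing f with
  | zero => rfl
  | succ j ih => rw [D_pow_succ_apply, D_compReal, ih, D_pow_succ_apply]

theorem smoothFun.aeval_compReal (φ : ℂ →L[ℝ] ℝ) (Q : ℝ[X]) (f : smoothFun ℂ) :
    aeval D Q (compReal φ f) = compReal φ (aeval D (Q.map (algebraMap ℝ ℂ)) f) := by
  induction Q using Polynomial.induction_on' with
  | add p q hp hq =>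
    rw [map_add, LinearMap.add_apply, hp, hq, Polynomial.map_add, map_add, LinearMap.add_apply]
    exact ext_apply fun x => (map_add φ _ _).symm
  | monomial n r =>
    rw [map_monomial, aeval_monomial, aeval_monomial, Algebra.algebraMap_eq_smul_one,
      Algebra.algebraMap_eq_smul_one, smul_one_mul, smul_one_mul, LinearMap.smul_apply,
      LinearMap.smul_apply, D_pow_compReal]
    refine ext_apply fun x => ?_
    change r * φ (((D ^ n) f).1 x) = φ ((r : ℂ) * ((D ^ n) f).1 x)
    rw [← Complex.real_smul, map_smul, smul_eq_mul]

/-- The complex conjugate of a smooth function. -/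
noncomputable def smoothFun.conj (f : smoothFun ℂ) : smoothFun ℂ :=
  ⟨fun x => starRingEnd ℂ (f.1 x), Complex.conjCLE.contDiff.comp (contDiff f)⟩

theorem smoothFun.D_conj (f : smoothFun ℂ) : D (conj f) = conj (D f) :=
  ext_apply fun x =>
    (Complex.conjCLE.toContinuousLinearMap.hasFDerivAt.comp_hasDerivAt x (hasDerivAt f x)).deriv

theorem smoothFun.D_pow_conj (j : ℕ) (f : smoothFun ℂ) : (D ^ j) (conj f) = conj ((D ^ j) f) := by
  induction j generalizing f with
  | zero => rfl
  | succ j ih => rw [D_pow_succ_apply, D_conj, ih, D_pow_succ_apply]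

theorem smoothFun.aeval_conj (P : ℂ[X]) (f : smoothFun ℂ) :
    aeval D (P.map (starRingEnd ℂ)) (conj f) = conj (aeval D P f) := by
  induction P using Polynomial.induction_on' with
  | add p q hp hq =>
    rw [Polynomial.map_add, map_add, LinearMap.add_apply, hp, hq, map_add, LinearMap.add_apply]
    exact ext_apply fun x => (map_add (starRingEnd ℂ) _ _).symm
  | monomial n r =>
    rw [map_monomial, aeval_monomial, aeval_monomial, Algebra.algebraMap_eq_smul_one,
      Algebra.algebraMap_eq_smul_one, smul_one_mul, smul_one_mul, LinearMap.smul_apply,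
      LinearMap.smul_apply, D_pow_conj]
    exact ext_apply fun x => (map_mul (starRingEnd ℂ) _ _).symm

theorem smoothFun.sum_apply {ι : Type*} (s : Finset ι) (F : ι → smoothFun ℂ) (x : ℝ) :
    (∑ i ∈ s, F i).1 x = ∑ i ∈ s, (F i).1 x := by
  rw [AddSubmonoidClass.coe_finsetSum, Finset.sum_apply]

/-- If the space of exponential polynomials is closed under conjugation, its characteristic
polynomial is real. -/
theorem map_conj_charPoly {N : ℕ} {Λ : Fin N → ℂ} (h : ClosedUnderConj (expPoly Λ)) :
    (charPoly Λ).map (starRingEnd ℂ) = charPoly Λ := by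
  have hm := charPoly_monic Λ
  rw [← sub_eq_zero]
  set R := (charPoly Λ).map (starRingEnd ℂ) - charPoly Λ with hR
  have hdeg : ∀ j, N ≤ j → R.coeff j = 0 := by
    intro j hj
    rw [hR, coeff_sub, coeff_map]
    rcases hj.lt_or_eq with hj | rfl
    · rw [coeff_eq_zero_of_natDegree_lt (by rwa [natDegree_charPoly]), map_zero, sub_zero]
    · have := hm.coeff_natDegree
      rw [natDegree_charPoly] at this
      rw [this, map_one, sub_self]
  ext j
  rw [coeff_zero]
  by_cases hj : N ≤ j
  · exact hdeg j hj
  push Not at hj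
  -- The difference `R` has degree below `N` and annihilates the whole space. On a solution with
  -- unit jet at index `j`, evaluation at 0 reads off the coefficient of index `j`.
  obtain ⟨f, hf, hjet⟩ := exists_mem_expSpace_jet Λ 0 fun i => if i = j then 1 else 0
  have h1 : conj f ∈ expSpace Λ := coe_mem_expPoly.1 (h _ (coe_mem_expPoly.2 hf))
  have h2 : aeval D ((charPoly Λ).map (starRingEnd ℂ)) f = 0 := by
    have h3 := aeval_conj (charPoly Λ) (conj f)
    rw [mem_expSpace.1 h1] at h3
    have h4 : conj (conj f) = f := ext_apply fun x => Complex.conj_conj _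
    rw [h4] at h3
    rw [h3]
    exact ext_apply fun x => map_zero (starRingEnd ℂ)
  have h5 : aeval D R f = 0 := by
    rw [hR, map_sub, LinearMap.sub_apply, h2, mem_expSpace.1 hf, sub_zero]
  have hRd : R.natDegree < N ∨ R = 0 := by
    by_cases h0 : R = 0
    · exact Or.inr h0
    · refine Or.inl (lt_of_not_ge fun hle => ?_)
      exact h0 (leadingCoeff_eq_zero.1 (hdeg _ hle))
  rcases hRd with hRd | h0
  · rw [aeval_eq_sum_range' hRd, LinearMap.sum_apply] at h5
    have h6 := congrArg (fun g : smoothFun ℂ => g.1 0) h5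
    simp only [smoothFun.sum_apply] at h6
    rw [Finset.sum_eq_single_of_mem j (Finset.mem_range.2 hj)] at h6
    · change R.coeff j * ((D ^ j) f).1 0 = 0 at h6
      rwa [hjet j hj, if_pos rfl, mul_one] at h6
    · intro i hi hij
      change R.coeff i * ((D ^ i) f).1 0 = 0
      rw [hjet i (Finset.mem_range.1 hi), if_neg hij, mul_zero]
  · rw [h0, coeff_zero]

/-! ### Two-point boundary value problems -/

/-- The characteristic polynomial is real and all its roots satisfy `(b - a) |Im z| < π`. -/
structure IsDisconjugate {N : ℕ} (Λ : Fin N → ℂ) (a b : ℝ) : Prop where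
  lt : a < b
  map_conj : (charPoly Λ).map (starRingEnd ℂ) = charPoly Λ
  width : ∀ i, (b - a) * |(Λ i).im| < Real.pi

theorem IsDisconjugate.removeNth {N : ℕ} {Λ : Fin (N + 1) → ℂ} {a b : ℝ}
    (h : IsDisconjugate Λ a b) (i : Fin (N + 1)) (hi : starRingEnd ℂ (Λ i) = Λ i) :
    IsDisconjugate (Fin.removeNth i Λ) a b where
  lt := h.lt
  map_conj := by
    have h1 := h.map_conj
    rw [charPoly_succAbove Λ i, Polynomial.map_mul, Polynomial.map_sub, map_X, map_C, hi] at h1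
    exact mul_left_cancel₀ (X_sub_C_ne_zero _) h1
  width j := h.width _

/-- Derivatives within a nondegenerate closed interval are unique, so the endpoints are included. -/
theorem smoothFun.vanishesTo_of_eq_zero_on_Icc {𝕜 : Type*} [RCLike 𝕜] {f : smoothFun 𝕜} {a b : ℝ}
    (hab : a < b) (h : ∀ x ∈ Set.Icc a b, f.1 x = 0) (i : ℕ) {c : ℝ} (hc : c ∈ Set.Icc a b) :
    VanishesTo f i c := by
  induction i generalizing f with
  | zero => exact vanishesTo_zero _ _
  | succ i ih =>
    refine vanishesTo_succ_iff.2 ⟨h c hc, ih fun x hx => ?_⟩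
    have hu := uniqueDiffOn_Icc hab x hx
    have h1 := (hasDerivAt f x).hasDerivWithinAt (s := Set.Icc a b)
    have h2 : HasDerivWithinAt f.1 0 (Set.Icc a b) x :=
      (hasDerivWithinAt_const x (Set.Icc a b) (0 : 𝕜)).congr (fun y hy => h y hy) (h x hx)
    rw [← h1.derivWithin hu, h2.derivWithin hu]

theorem smoothFun.VanishesTo.compReal {f : smoothFun ℂ} {i : ℕ} {c : ℝ} (φ : ℂ →L[ℝ] ℝ)
    (h : VanishesTo f i c) : VanishesTo (compReal φ f) i c := fun j hj => by
  rw [D_pow_compReal]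
  change φ _ = 0
  rw [h j hj, map_zero]

theorem IsDisconjugate.exists_real {N : ℕ} {Λ : Fin N → ℂ} {a b : ℝ} (h : IsDisconjugate Λ a b) :
    ∃ Q : ℝ[X], Q.Monic ∧ Q.natDegree = N ∧ Q.map (algebraMap ℝ ℂ) = charPoly Λ ∧
      ∀ z : ℂ, aeval z Q = 0 → (b - a) * |z.im| < Real.pi := by
  have hl : charPoly Λ ∈ lifts (algebraMap ℝ ℂ) := by
    rw [lifts_iff_coeff_lifts]
    intro j
    have h1 := congrArg (fun P => coeff P j) h.map_conj
    simp only [coeff_map] at h1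
    exact ⟨((charPoly Λ).coeff j).re, Complex.conj_eq_iff_re.1 h1⟩
  obtain ⟨Q, hQ, hdeg, hm⟩ := lifts_and_natDegree_eq_and_monic hl (charPoly_monic Λ)
  refine ⟨Q, hm, hdeg.trans (natDegree_charPoly Λ), hQ, fun z hz => ?_⟩
  rw [← eval_map_algebraMap, hQ, charPoly, eval_prod, Finset.prod_eq_zero_iff] at hz
  obtain ⟨i, -, hi⟩ := hz
  rw [eval_sub, eval_X, eval_C, sub_eq_zero] at hi
  rw [hi]
  exact h.width i

theorem IsDisconjugate.compReal_eq_zero {N : ℕ} {Λ : Fin N → ℂ} {a b : ℝ}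
    (h : IsDisconjugate Λ a b) (φ : ℂ →L[ℝ] ℝ) {f : smoothFun ℂ} (hf : f ∈ expSpace Λ)
    (hz : ZeroCount a b (compReal φ f) N) : ∀ x ∈ Set.Icc a b, φ (f.1 x) = 0 := by
  obtain ⟨Q, hm, hdeg, hmap, hr⟩ := h.exists_real
  refine eq_zero_of_zeroCount h.lt Q hm hr (compReal φ f) (fun x _ => ?_) (by rwa [hdeg])
  rw [aeval_compReal, hmap, mem_expSpace.1 hf]
  exact map_zero φ

/-- An exponential polynomial with as many zeros at the two endpoints as the dimension of the
space is zero. -/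
theorem IsDisconjugate.eq_zero {N : ℕ} {Λ : Fin N → ℂ} {a b : ℝ} (h : IsDisconjugate Λ a b)
    {f : smoothFun ℂ} (hf : f ∈ expSpace Λ) {i j : ℕ} (hij : N ≤ i + j) (ha : VanishesTo f i a)
    (hb : VanishesTo f j b) : f = 0 := by
  have h1 : ∀ φ : ℂ →L[ℝ] ℝ, ∀ x ∈ Set.Icc a b, φ (f.1 x) = 0 := fun φ =>
    h.compReal_eq_zero φ hf ⟨i, j, ∅, by simpa using hij, ha.compReal φ, hb.compReal φ, by simp⟩
  refine eq_zero_of_vanishesTo hf (a := a)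
    (vanishesTo_of_eq_zero_on_Icc h.lt (fun x hx => ?_) N (Set.left_mem_Icc.2 h.lt.le))
  exact Complex.ext (h1 Complex.reCLM x hx) (h1 Complex.imCLM x hx)

/-- The sign of the leading derivative at `b` of an exponential polynomial with all but one of
the possible zeros at the endpoints. -/
theorem IsDisconjugate.sign {N : ℕ} {Λ : Fin N → ℂ} {a b : ℝ} (h : IsDisconjugate Λ a b)
    {f : smoothFun ℂ} (hf : f ∈ expSpace Λ) {k j : ℕ} (hkj : k + j + 1 = N)
    (ha : VanishesTo f k a) (hb : VanishesTo f j b) {v : ℝ} (hv : 0 < v)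
    (hav : ((D ^ k) f).1 a = v) : ∃ u : ℝ, 0 < u ∧ ((D ^ j) f).1 b = ((-1) ^ j * u : ℝ) := by
  have hab := h.lt
  have haI : a ∈ Set.Icc a b := Set.left_mem_Icc.2 hab.le
  have hbI : b ∈ Set.Icc a b := Set.right_mem_Icc.2 hab.le
  -- The leading derivative at `a` is real, so the imaginary part has one more zero there and
  -- vanishes on [a, b].
  have him : ((D ^ j) f).1 b = (((D ^ j) f).1 b).re := by
    refine Complex.ext rfl ?_
    rw [Complex.ofReal_im]
    have h1 : VanishesTo (compReal Complex.imCLM f) (k + 1) a := by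
      refine vanishesTo_succ_iff'.2 ⟨ha.compReal _, ?_⟩
      rw [D_pow_compReal]
      change (((D ^ k) f).1 a).im = 0
      rw [hav, Complex.ofReal_im]
    have h2 := h.compReal_eq_zero Complex.imCLM hf
      ⟨k + 1, j, ∅, by simp; omega, h1, hb.compReal _, by simp⟩
    have h3 := vanishesTo_of_eq_zero_on_Icc (f := compReal Complex.imCLM f) hab h2 (j + 1) hbI j
      (Nat.lt_succ_self j)
    rw [D_pow_compReal] at h3
    exact h3
  set g := compReal Complex.reCLM f with hg
  have hga : VanishesTo g k a := ha.compReal _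
  have hgb : VanishesTo g j b := hb.compReal _
  have hgk : ((D ^ k) g).1 a = v := by
    rw [hg, D_pow_compReal]
    change (((D ^ k) f).1 a).re = v
    rw [hav, Complex.ofReal_re]
  have hgj : ((D ^ j) g).1 b = (((D ^ j) f).1 b).re := by
    rw [hg, D_pow_compReal]
    rfl
  have hno : ¬ ZeroCount a b g N := by
    intro hz
    have h1 := vanishesTo_of_eq_zero_on_Icc (f := g) hab
      (h.compReal_eq_zero Complex.reCLM hf hz) (k + 1) haI k (Nat.lt_succ_self k)
    exact hv.ne' (hgk.symm.trans h1)
  -- The endpoints already hold N - 1 zeros of the real part. With none inside, its sign is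
  -- constant: positive near `a`, hence up to `b`.
  have hne : ∀ x ∈ Set.Ioo a b, g.1 x ≠ 0 := by
    intro x hx hgx
    refine hno ⟨k, j, {x}, by simp; omega, hga, hgb, fun y hy => ?_⟩
    rw [Finset.mem_singleton.1 hy]
    exact ⟨hx, hgx⟩
  obtain ⟨x₀, hx₀, hpos₀⟩ : ∃ x ∈ Set.Ioo a b, 0 < g.1 x := by
    have h1 := hga.tendsto_div_pow.mono_left
      (nhdsWithin_mono a (show Set.Ioi a ⊆ {a}ᶜ from fun x hx => (Set.mem_Ioi.1 hx).ne'))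
    have h2 : 0 < ((k.factorial : ℝ)⁻¹) • ((D ^ k) g).1 a := by
      rw [hgk, smul_eq_mul]; positivity
    have h3 := (h1.eventually (lt_mem_nhds h2)).and (Ioo_mem_nhdsGT hab)
    obtain ⟨x, hx, hxI⟩ := h3.exists
    refine ⟨x, hxI, ?_⟩
    have h4 : 0 < ((x - a) ^ k)⁻¹ := inv_pos.2 (pow_pos (sub_pos.2 hxI.1) _)
    exact (mul_pos_iff_of_pos_left h4).1 hx
  have hpos : ∀ x ∈ Set.Ioo a b, 0 < g.1 x := by
    intro x hx
    by_contra hle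
    have h1 : (0 : ℝ) ∈ g.1 '' Set.Ioo a b :=
      isPreconnected_Ioo.intermediate_value hx hx₀ (smoothFun.continuous g).continuousOn
        ⟨not_lt.1 hle, hpos₀.le⟩
    obtain ⟨y, hy, hy0⟩ := h1
    exact hne y hy hy0
  have hge : 0 ≤ (-1) ^ j * ((D ^ j) g).1 b := by
    have h1 := (hgb.tendsto_div_pow.mono_left (nhdsWithin_mono b
      (show Set.Iio b ⊆ {b}ᶜ from fun x hx => (Set.mem_Iio.1 hx).ne))).const_mul ((-1 : ℝ) ^ j)
    have h2 : 0 ≤ (-1) ^ j * (((j.factorial : ℝ)⁻¹) • ((D ^ j) g).1 b) := by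
      refine ge_of_tendsto h1 ?_
      filter_upwards [Ioo_mem_nhdsLT hab] with x hx
      have h3 : (-1 : ℝ) ^ j * ((x - b) ^ j)⁻¹ = ((b - x) ^ j)⁻¹ := by
        rw [← neg_sub b x, neg_pow (b - x) j, mul_inv, ← inv_pow, ← mul_assoc, ← mul_pow]
        norm_num
      rw [smul_eq_mul, ← mul_assoc, h3]
      exact mul_nonneg (inv_nonneg.2 (pow_nonneg (sub_nonneg.2 hx.2.le) _)) (hpos x hx).le
    rw [smul_eq_mul, mul_left_comm] at h2
    exact (mul_nonneg_iff_of_pos_left (by positivity)).1 h2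
  -- A further zero at `b` would be the N-th.
  have hjne : ((D ^ j) g).1 b ≠ 0 := fun h0 => hno
    ⟨k, j + 1, ∅, by simp; omega, hga, vanishesTo_succ_iff'.2 ⟨hgb, h0⟩, by simp⟩
  refine ⟨(-1) ^ j * ((D ^ j) g).1 b,
    lt_of_le_of_ne hge (mul_ne_zero (by simp) hjne).symm, ?_⟩
  rw [him, ← hgj, ← mul_assoc, ← mul_pow]
  norm_num

/-! ### Bernstein bases -/

/-- A Bernstein basis consisting of bundled smooth functions. -/
def IsSmoothBernstein {n : ℕ} (Λ : Fin (n + 1) → ℂ) (a b : ℝ) (p : Fin (n + 1) → smoothFun ℂ) :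
    Prop :=
  ∀ k : Fin (n + 1), p k ∈ expSpace Λ ∧ VanishesTo (p k) k a ∧ ((D ^ (k : ℕ)) (p k)).1 a = 1 ∧
    VanishesTo (p k) (n - k) b

theorem IsBernsteinBasis.exists_smooth {n : ℕ} {Λ : Fin (n + 1) → ℂ} {a b : ℝ}
    {P : Fin (n + 1) → ℝ → ℂ} (h : IsBernsteinBasis Λ a b P) :
    ∃ p, IsSmoothBernstein Λ a b p ∧ P = fun k => (p k).1 := by
  refine ⟨fun k => ⟨P k, (h k).1.1⟩, fun k => ⟨coe_mem_expPoly.1 (h k).1, ?_, ?_, ?_⟩, rfl⟩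
  · intro j hj
    rw [coe_D_pow]
    exact (h k).2.1.1 j hj
  · rw [coe_D_pow]
    exact (h k).2.2.2
  · intro j hj
    rw [coe_D_pow]
    exact (h k).2.2.1.1 j hj

/-- In particular the zero at `b` has the exact order, which is why `IsSmoothBernstein` need not
require it. -/
theorem IsSmoothBernstein.end_sign {n : ℕ} {Λ : Fin (n + 1) → ℂ} {a b : ℝ}
    (h : IsDisconjugate Λ a b) {p : Fin (n + 1) → smoothFun ℂ} (hp : IsSmoothBernstein Λ a b p)
    (k : Fin (n + 1)) :
    ∃ u : ℝ, 0 < u ∧ ((D ^ (n - (k : ℕ))) (p k)).1 b = ((-1) ^ (n - (k : ℕ)) * u : ℝ) :=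
  h.sign (hp k).1 (by omega) (hp k).2.1 (hp k).2.2.2 one_pos (by rw [(hp k).2.2.1]; simp)

theorem IsSmoothBernstein.isBernsteinBasis {n : ℕ} {Λ : Fin (n + 1) → ℂ} {a b : ℝ}
    (h : IsDisconjugate Λ a b) {p : Fin (n + 1) → smoothFun ℂ}
    (hp : IsSmoothBernstein Λ a b p) : IsBernsteinBasis Λ a b fun k => (p k).1 := by
  intro k
  refine ⟨coe_mem_expPoly.2 (hp k).1, ⟨fun j hj => ?_, ?_⟩, ⟨fun j hj => ?_, ?_⟩, ?_⟩
  · rw [← coe_D_pow]; exact (hp k).2.1 j hj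
  · rw [← coe_D_pow, (hp k).2.2.1]; exact one_ne_zero
  · rw [← coe_D_pow]; exact (hp k).2.2.2 j hj
  · obtain ⟨u, hu, h1⟩ := hp.end_sign h k
    rw [← coe_D_pow, h1]
    exact Complex.ofReal_ne_zero.2 (mul_ne_zero (by simp) hu.ne')
  · rw [← coe_D_pow]; exact (hp k).2.2.1

theorem IsSmoothBernstein.unique {n : ℕ} {Λ : Fin (n + 1) → ℂ} {a b : ℝ}
    (h : IsDisconjugate Λ a b) {p q : Fin (n + 1) → smoothFun ℂ}
    (hp : IsSmoothBernstein Λ a b p) (hq : IsSmoothBernstein Λ a b q) : p = q := by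
  funext k
  refine sub_eq_zero.1 (h.eq_zero (sub_mem (hp k).1 (hq k).1) (i := k + 1) (j := n - k) (by omega)
    (vanishesTo_succ_iff'.2 ⟨(hp k).2.1.sub (hq k).2.1, ?_⟩) ((hp k).2.2.2.sub (hq k).2.2.2))
  rw [map_sub]
  exact sub_eq_zero.2 ((hp k).2.2.1.trans (hq k).2.2.1.symm)

theorem IsDisconjugate.exists_smoothBernstein {n : ℕ} {Λ : Fin (n + 1) → ℂ} {a b : ℝ}
    (h : IsDisconjugate Λ a b) : ∃ p, IsSmoothBernstein Λ a b p := by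
  suffices H : ∀ k : Fin (n + 1), ∃ f ∈ expSpace Λ, VanishesTo f k a ∧
      ((D ^ (k : ℕ)) f).1 a = 1 ∧ VanishesTo f (n - k) b by
    choose p hp using H
    exact ⟨p, hp⟩
  intro k
  obtain ⟨e⟩ := nonempty_expSpace_linearEquiv Λ
  -- Two-point data: k + 1 derivatives at `a`, then n - k at `b`. Zero counting makes the map
  -- injective, hence bijective by dimension; the k-th unit vector gives p_k.
  let K : (Fin (n + 1) → ℂ) →ₗ[ℂ] (Fin (n + 1) → ℂ) :=
    { toFun := fun c i => if i ≤ k then ((D ^ (i : ℕ)) (e.symm c).1).1 a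
        else ((D ^ ((i : ℕ) - k - 1)) (e.symm c).1).1 b
      map_add' := fun c d => funext fun i => by
        rw [map_add, Submodule.coe_add, map_add, map_add]
        by_cases hi : i ≤ k
        · simp only [hi, if_true, Pi.add_apply]; rfl
        · simp only [hi, if_false, Pi.add_apply]; rfl
      map_smul' := fun r c => funext fun i => by
        rw [map_smul, Submodule.coe_smul, map_smul, map_smul]
        by_cases hi : i ≤ k
        · simp only [hi, if_true, Pi.smul_apply]; rfl
        · simp only [hi, if_false, Pi.smul_apply]; rfl }
  have hK : ∀ c i, K c i = if i ≤ k then ((D ^ (i : ℕ)) (e.symm c).1).1 a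
        else ((D ^ ((i : ℕ) - k - 1)) (e.symm c).1).1 b := fun c i => rfl
  have ha : ∀ c, ∀ j : ℕ, ∀ hj : j ≤ k, K c ⟨j, by omega⟩ = ((D ^ j) (e.symm c).1).1 a := by
    intro c j hj
    rw [hK, if_pos (show (⟨j, by omega⟩ : Fin (n + 1)) ≤ k from hj)]
  have hb : ∀ c, ∀ j : ℕ, ∀ hj : j < n - k,
      K c ⟨k + 1 + j, by omega⟩ = ((D ^ j) (e.symm c).1).1 b := by
    intro c j hj
    rw [hK, if_neg (show ¬ (⟨k + 1 + j, by omega⟩ : Fin (n + 1)) ≤ k by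
      rw [Fin.le_def]; simp only; omega)]
    have : (k : ℕ) + 1 + j - k - 1 = j := by omega
    simp only [this]
  have hinj : Function.Injective K := by
    refine (injective_iff_map_eq_zero K).2 fun c hc => ?_
    have h0 : (e.symm c).1 = 0 := by
      refine h.eq_zero (e.symm c).2 (i := k + 1) (j := n - k) (by omega) (fun j hj => ?_)
        (fun j hj => ?_)
      · rw [← ha c j (by omega), hc]; rfl
      · rw [← hb c j hj, hc]; rfl
    have h1 : e.symm c = 0 := Subtype.ext h0
    exact e.symm.injective (h1.trans (LinearEquiv.map_zero e.symm).symm)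
  obtain ⟨c, hc⟩ := LinearMap.injective_iff_surjective.1 hinj (Pi.single k 1)
  refine ⟨(e.symm c).1, (e.symm c).2, fun j hj => ?_, ?_, fun j hj => ?_⟩
  · rw [← ha c j hj.le, hc, Pi.single_apply, if_neg (by rw [Fin.ext_iff]; simp only; omega)]
  · rw [← ha c k le_rfl, hc, Fin.eta, Pi.single_eq_same]
  · rw [← hb c j hj, hc, Pi.single_apply, if_neg (by rw [Fin.ext_iff]; simp only; omega)]

theorem IsDisconjugate.existsUnique_bernsteinBasis {n : ℕ} {Λ : Fin (n + 1) → ℂ} {a b : ℝ}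
    (h : IsDisconjugate Λ a b) : ∃! p, IsBernsteinBasis Λ a b p := by
  obtain ⟨p, hp⟩ := h.exists_smoothBernstein
  refine ⟨_, hp.isBernsteinBasis h, fun q hq => ?_⟩
  obtain ⟨q', hq', rfl⟩ := hq.exists_smooth
  rw [hp.unique h hq']

theorem IsDisconjugate.bernsteinBasis_eq {n : ℕ} {Λ : Fin (n + 1) → ℂ} {a b : ℝ}
    (h : IsDisconjugate Λ a b) :
    ∃ p, IsSmoothBernstein Λ a b p ∧ bernsteinBasis Λ a b = fun k => (p k).1 :=
  IsBernsteinBasis.exists_smooth (Classical.epsilon_spec h.existsUnique_bernsteinBasis.exists)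

/-! ### Recurrences between Bernstein bases -/

theorem smoothFun.D_pow_sub_smul_apply (j : ℕ) (f g : smoothFun ℂ) (μ : ℂ) (x : ℝ) :
    ((D ^ j) (f - μ • g)).1 x = ((D ^ j) f).1 x - μ * ((D ^ j) g).1 x := by
  rw [map_sub, map_smul]
  rfl

/-- `(d/dx - Λ i) p_k = q_{k-1} + c_k q_k` for the Bernstein bases `p` of `Λ` and `q` of `Λ` with
`Λ i` removed. -/
theorem IsSmoothBernstein.recurrence {m : ℕ} {Λ : Fin (m + 2) → ℂ} {a b : ℝ} {i : Fin (m + 2)}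
    (h : IsDisconjugate (Fin.removeNth i Λ) a b) {p : Fin (m + 2) → smoothFun ℂ}
    (hp : IsSmoothBernstein Λ a b p) {q : Fin (m + 1) → smoothFun ℂ}
    (hq : IsSmoothBernstein (n := m) (Fin.removeNth i Λ) a b q) {c : Fin (m + 1) → ℂ}
    (hc : ∀ k : Fin (m + 1), ((D ^ (m + 1 - (k : ℕ))) (p k.castSucc)).1 b
      = c k * ((D ^ (m - (k : ℕ))) (q k)).1 b) (k : Fin (m + 2)) :
    D (p k) - Λ i • p k = (Fin.cons 0 q : Fin (m + 2) → smoothFun ℂ) k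
      + (Fin.snoc (fun j => c j • q j) 0 : Fin (m + 2) → smoothFun ℂ) k := by
  set A := (Fin.cons 0 q : Fin (m + 2) → smoothFun ℂ) k with hA
  set B := (Fin.snoc (fun j => c j • q j) 0 : Fin (m + 2) → smoothFun ℂ) k with hB
  obtain ⟨hpE, hpa, hpk, hpb⟩ := hp k
  have hzero : ∀ j x, ((D ^ j) (0 : smoothFun ℂ)).1 x = 0 := fun j x => by rw [map_zero]; rfl
  have hA' : A ∈ expSpace (Fin.removeNth i Λ) ∧ VanishesTo A (k - 1) a ∧
      (1 ≤ (k : ℕ) → ((D ^ ((k : ℕ) - 1)) A).1 a = 1) ∧ VanishesTo A (m + 1 - k) b := by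
    rw [hA]
    induction k using Fin.cases with
    | zero =>
      rw [Fin.cons_zero]
      exact ⟨zero_mem _, fun j _ => hzero j a, fun h => absurd h (by simp), fun j _ => hzero j b⟩
    | succ k =>
      rw [Fin.cons_succ]
      refine ⟨(hq k).1, by simpa using (hq k).2.1, fun _ => by simpa using (hq k).2.2.1, ?_⟩
      have := (hq k).2.2.2
      rwa [Fin.val_succ, Nat.add_sub_add_right]
  have hB' : B ∈ expSpace (Fin.removeNth i Λ) ∧ VanishesTo B k a ∧ VanishesTo B (m - k) b ∧
      ((k : ℕ) ≤ m → ((D ^ (m - (k : ℕ))) B).1 b = ((D ^ (m + 1 - (k : ℕ))) (p k)).1 b) := by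
    rw [hB]
    induction k using Fin.lastCases with
    | last =>
      rw [Fin.snoc_last]
      exact ⟨zero_mem _, fun j _ => hzero j a, fun j _ => hzero j b, fun h => absurd h (by simp)⟩
    | cast k =>
      rw [Fin.snoc_castSucc]
      refine ⟨Submodule.smul_mem _ _ (hq k).1, (hq k).2.1.smul _, (hq k).2.2.2.smul _, fun _ => ?_⟩
      rw [Fin.val_castSucc, hc, map_smul]
      rfl
  have hadd : ∀ j x, ((D ^ j) (D (p k) - Λ i • p k - (A + B))).1 x
      = ((D ^ (j + 1)) (p k)).1 x - Λ i * ((D ^ j) (p k)).1 x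
        - (((D ^ j) A).1 x + ((D ^ j) B).1 x) := by
    intro j x
    rw [map_sub, map_sub, map_add, map_smul, D_pow_succ_apply]
    rfl
  -- The difference lies in a space of dimension m + 1 and gets k zeros at `a` and m + 1 - k at `b`.
  -- The last one at `a` comes from the normalizations, the last one at `b` from the choice of `c`.
  refine sub_eq_zero.1 (h.eq_zero (sub_mem ((D_sub_smul_mem_expSpace_iff i).2 hpE)
    (add_mem hA'.1 hB'.1)) (i := k) (j := m + 1 - k) (by omega) (fun j hj => ?_) (fun j hj => ?_))
  · rw [hadd, hpa j hj, hB'.2.1 j hj, mul_zero, sub_zero, add_zero]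
    by_cases hj1 : j + 1 < k
    · rw [hpa _ hj1, hA'.2.1 j (by omega), sub_zero]
    · have hj2 : j + 1 = k := by omega
      have hj3 : (k : ℕ) - 1 = j := by omega
      have h1 := hA'.2.2.1 (by omega)
      rw [hj3] at h1
      rw [hj2, hpk, h1, sub_self]
  · rw [hadd, hpb j hj, hA'.2.2.2 j hj, mul_zero, sub_zero, zero_add]
    by_cases hj1 : j + 1 < m + 1 - k
    · rw [hpb _ hj1, hB'.2.2.1 j (by omega), sub_zero]
    · have hj2 : j + 1 = m + 1 - k := by omega
      have hj3 : m - (k : ℕ) = j := by omega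
      have h1 := hB'.2.2.2 (by omega)
      rw [hj3] at h1
      rw [hj2, h1, sub_self]

theorem IsSmoothBernstein.apply_left {n : ℕ} {Λ : Fin (n + 1) → ℂ} {a b : ℝ}
    {p : Fin (n + 1) → smoothFun ℂ} (hp : IsSmoothBernstein Λ a b p) {k : Fin (n + 1)}
    (hk : k ≠ 0) : (p k).1 a = 0 :=
  (hp k).2.1 0 (Nat.pos_of_ne_zero fun h => hk (Fin.ext h))

/-- The expansion of an exponential in the Bernstein basis. -/
theorem IsSmoothBernstein.sum_eq_cexp {m : ℕ} {Λ : Fin (m + 2) → ℂ} {a b : ℝ} {i : Fin (m + 2)}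
    (h : IsDisconjugate (Fin.removeNth i Λ) a b) {p : Fin (m + 2) → smoothFun ℂ}
    (hp : IsSmoothBernstein Λ a b p) {q : Fin (m + 1) → smoothFun ℂ}
    (hq : IsSmoothBernstein (n := m) (Fin.removeNth i Λ) a b q) {c : Fin (m + 1) → ℂ}
    (hc : ∀ k : Fin (m + 1), ((D ^ (m + 1 - (k : ℕ))) (p k.castSucc)).1 b
      = c k * ((D ^ (m - (k : ℕ))) (q k)).1 b) {β : Fin (m + 2) → ℂ}
    (h0 : β 0 = Complex.exp (Λ i * a)) (hβ : ∀ k : Fin (m + 1), β k.succ = -c k * β k.castSucc) :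
    ∑ k, β k • p k = cexp (Λ i) := by
  have hD : D (∑ k, β k • p k) - Λ i • ∑ k, β k • p k = 0 := by
    have h1 : D (∑ k, β k • p k) - Λ i • ∑ k, β k • p k
        = ∑ k, β k • (D (p k) - Λ i • p k) := by
      rw [map_sum, Finset.smul_sum, ← Finset.sum_sub_distrib]
      refine Finset.sum_congr rfl fun k _ => ?_
      rw [map_smul, smul_sub, smul_comm]
    rw [h1]
    simp only [hp.recurrence h hq hc, smul_add, Finset.sum_add_distrib]
    rw [Fin.sum_univ_succ, Fin.sum_univ_castSucc (fun k => β k • (Fin.snoc _ _ : Fin (m + 2) → _) k)]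
    simp only [Fin.cons_zero, Fin.cons_succ, Fin.snoc_castSucc, Fin.snoc_last, smul_zero, zero_add,
      add_zero]
    rw [← Finset.sum_add_distrib]
    -- After the index shift, the coefficient of q_k is β_{k+1} + c_k β_k, which is 0 by `hβ`.
    refine Finset.sum_eq_zero fun k _ => ?_
    rw [hβ, smul_smul, ← add_smul, neg_mul, mul_comm, neg_add_cancel, zero_smul]
  refine sub_eq_zero.1 (eq_zero_of_D_eq_smul (μ := Λ i) (a := a) ?_ ?_)
  · rw [map_sub, smul_sub, D_cexp, sub_sub_sub_comm, hD, sub_self, sub_zero]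
  · change (∑ k, β k • p k).1 a - Complex.exp (Λ i * a) = 0
    rw [smoothFun.sum_apply, Finset.sum_eq_single 0]
    · change β 0 * (p 0).1 a - _ = 0
      have h2 : (p 0).1 a = 1 := (hp 0).2.2.1
      rw [h2, h0, mul_one, sub_self]
    · intro k _ hk
      change β k * (p k).1 a = 0
      rw [hp.apply_left hk, mul_zero]
    · simp

/-- The jets of the basis at `a` form a triangular matrix with unit diagonal. -/
theorem IsSmoothBernstein.coeff_eq {n : ℕ} {Λ : Fin (n + 1) → ℂ} {a b : ℝ}
    (hab : a < b) {p : Fin (n + 1) → smoothFun ℂ} (hp : IsSmoothBernstein Λ a b p)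
    {β γ : Fin (n + 1) → ℂ}
    (h : ∀ x ∈ Set.Icc a b, ∑ k, β k * (p k).1 x = ∑ k, γ k * (p k).1 x) : β = γ := by
  have h1 : ∀ x ∈ Set.Icc a b, (∑ k, (β k - γ k) • p k).1 x = 0 := by
    intro x hx
    rw [smoothFun.sum_apply]
    change ∑ k, (β k - γ k) * (p k).1 x = 0
    simp only [sub_mul, Finset.sum_sub_distrib]
    rw [h x hx, sub_self]
  have h2 : ∀ j : ℕ, ∑ k, (β k - γ k) * ((D ^ j) (p k)).1 a = 0 := by
    intro j
    have h3 := vanishesTo_of_eq_zero_on_Icc hab h1 (j + 1) (Set.left_mem_Icc.2 hab.le) j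
      (Nat.lt_succ_self j)
    rw [map_sum, smoothFun.sum_apply] at h3
    rw [← h3]
    refine Finset.sum_congr rfl fun k _ => ?_
    rw [map_smul]
    rfl
  funext k
  induction k using WellFoundedLT.induction with
  | ind k ih =>
  have h4 := h2 k
  rw [Finset.sum_eq_single_of_mem k (Finset.mem_univ k), (hp k).2.2.1, mul_one] at h4
  · exact sub_eq_zero.1 h4
  · intro l _ hl
    rcases lt_or_gt_of_ne hl with hl | hl
    · rw [ih l hl, sub_self, zero_mul]
    · rw [(hp l).2.1 k hl, mul_zero]

/-- Raising an eigenvalue raises the modulus of the end derivatives of the Bernstein basis. -/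
theorem IsSmoothBernstein.end_lt {m : ℕ} {Λ : Fin (m + 2) → ℂ} {a b l₀ l₁ : ℝ}
    (h₀ : Λ 0 = l₀) (h₁ : Λ 1 = l₁) (hlt : l₀ < l₁) (h : IsDisconjugate Λ a b)
    {p : Fin (m + 2) → smoothFun ℂ} (hp : IsSmoothBernstein Λ a b p)
    {q : Fin (m + 1) → smoothFun ℂ} (hq : IsSmoothBernstein (n := m) (Fin.removeNth 0 Λ) a b q)
    {r : Fin (m + 1) → smoothFun ℂ} (hr : IsSmoothBernstein (n := m) (Fin.removeNth 1 Λ) a b r)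
    (k : Fin (m + 1)) {Q R : ℝ}
    (hQ : ((D ^ (m - (k : ℕ))) (q k)).1 b = ((-1) ^ (m - (k : ℕ)) * Q : ℝ))
    (hR : ((D ^ (m - (k : ℕ))) (r k)).1 b = ((-1) ^ (m - (k : ℕ)) * R : ℝ)) : R < Q := by
  by_contra hle
  rw [not_lt] at hle
  have hk : (k : ℕ) ≤ m := Nat.lt_succ_iff.1 k.2
  obtain ⟨P, hP, hPb⟩ := hp.end_sign h k.succ
  obtain ⟨hpE, hpa, hpk, hpb⟩ := hp k.succ
  obtain ⟨hqE, hqa, hqk, hqb⟩ := hq k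
  obtain ⟨hrE, hra, hrk, hrb⟩ := hr k
  rw [Fin.val_succ] at hpa hpk
  rw [Fin.val_succ, Nat.add_sub_add_right] at hPb hpb
  -- Both normalizations agree, so q_k - r_k has order at least k + 1 at `a` and m - k at `b`, and
  -- is a multiple of p_{k+1}; comparing leading derivatives at `b` gives the factor. The assumption
  -- Q ≤ R makes it nonpositive.
  set δ : ℝ := (Q - R) / P with hδ
  have hδ0 : δ ≤ 0 := div_nonpos_of_nonpos_of_nonneg (by linarith) hP.le
  have hdiff : q k - r k = (δ : ℂ) • p k.succ := by
    refine sub_eq_zero.1 (h.eq_zero (i := k + 1) (j := m - k + 1)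
      (sub_mem (sub_mem (removeNth_mem_expSpace 0 hqE) (removeNth_mem_expSpace 1 hrE))
        (Submodule.smul_mem _ _ hpE)) (by omega) ?_ ?_)
    · refine (vanishesTo_succ_iff'.2 ⟨hqa.sub hra, ?_⟩).sub (hpa.smul _)
      rw [map_sub]
      exact sub_eq_zero.2 (hqk.trans hrk.symm)
    · refine vanishesTo_succ_iff'.2 ⟨(hqb.sub hrb).sub (hpb.smul _), ?_⟩
      rw [D_pow_sub_smul_apply, map_sub]
      change ((D ^ (m - (k : ℕ))) (q k)).1 b - ((D ^ (m - (k : ℕ))) (r k)).1 b - _ = 0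
      rw [hQ, hR, hPb, ← Complex.ofReal_sub, ← Complex.ofReal_mul, ← Complex.ofReal_sub, hδ]
      have : (-1) ^ (m - (k : ℕ)) * Q - (-1) ^ (m - (k : ℕ)) * R
          - (Q - R) / P * ((-1) ^ (m - (k : ℕ)) * P) = 0 := by
        field_simp
        ring
      rw [this, Complex.ofReal_zero]
  have hconj₀ : starRingEnd ℂ (Λ 0) = Λ 0 := by rw [h₀, Complex.conj_ofReal]
  have hconj₁ : starRingEnd ℂ (Λ 1) = Λ 1 := by rw [h₁, Complex.conj_ofReal]
  have hd := (h.removeNth 0 hconj₀).removeNth (0 : Fin (m + 1)) hconj₁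
  have hΛ : Fin.removeNth (0 : Fin (m + 1)) (Fin.removeNth 1 Λ)
      = Fin.removeNth (0 : Fin (m + 1)) (Fin.removeNth 0 Λ) := by
    funext j
    rfl
  -- up to sign, `g` is a multiple of an element of the Bernstein basis of the common subspace
  set g : smoothFun ℂ := (D (r k) - (l₀ : ℂ) • r k) - (D (q k) - (l₁ : ℂ) • q k) with hg
  have hgE : g ∈ expSpace (Fin.removeNth (0 : Fin (m + 1)) (Fin.removeNth 0 Λ)) := by
    refine sub_mem ?_ ?_
    · rw [← hΛ, ← h₀]
      exact (D_sub_smul_mem_expSpace_iff (Λ := (Fin.removeNth 1 Λ : Fin (m + 1) → ℂ)) 0).2 hrE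
    · rw [← h₁]
      exact (D_sub_smul_mem_expSpace_iff (Λ := (Fin.removeNth 0 Λ : Fin (m + 1) → ℂ)) 0).2 hqE
  have hgj : ∀ j x, ((D ^ j) g).1 x = -(((D ^ (j + 1)) (q k - r k)).1 x)
      - l₀ * ((D ^ j) (r k)).1 x + l₁ * ((D ^ j) (q k)).1 x := by
    intro j x
    have h1 : ((D ^ j) g).1 x = (((D ^ (j + 1)) (r k)).1 x - l₀ * ((D ^ j) (r k)).1 x)
        - (((D ^ (j + 1)) (q k)).1 x - l₁ * ((D ^ j) (q k)).1 x) := by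
      rw [hg, map_sub, map_sub, map_sub, map_smul, map_smul, D_pow_succ_apply, D_pow_succ_apply]
      rfl
    have h2 : ((D ^ (j + 1)) (q k - r k)).1 x
        = ((D ^ (j + 1)) (q k)).1 x - ((D ^ (j + 1)) (r k)).1 x := by
      rw [map_sub]
      rfl
    rw [h1, h2]
    ring
  have hsm : ∀ j x, ((D ^ j) (q k - r k)).1 x = δ * ((D ^ j) (p k.succ)).1 x := by
    intro j x
    rw [hdiff, map_smul]
    rfl
  have hga : VanishesTo g k a := by
    intro j hj
    rw [hgj, hsm, hpa _ (by omega), hra j hj, hqa j hj]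
    simp
  have hgk : ((D ^ (k : ℕ)) g).1 a = ((l₁ - l₀ - δ : ℝ) : ℂ) := by
    rw [hgj, hsm, hpk, hrk, hqk]
    push_cast
    ring
  have hv : 0 < l₁ - l₀ - δ := by linarith
  -- The leading derivative of `g` at `a` is positive, and at `b` it is (-1)^{m-k-1}(Q - R), so the
  -- sign rule forces Q > R. For k = m no zero at `b` is involved: `g` has m zeros at `a` in a space
  -- of dimension m, contradicting `hgk`.
  rcases hk.lt_or_eq with hkm | hkm
  · have hgb : VanishesTo g (m - k - 1) b := by
      intro j hj
      rw [hgj, hsm, hpb _ (by omega), hrb j (by omega), hqb j (by omega)]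
      simp
    obtain ⟨u, hu, h3⟩ := hd.sign hgE (by omega) hga hgb hv hgk
    have hj : m - (k : ℕ) - 1 + 1 = m - k := by omega
    have h4 : ((D ^ (m - (k : ℕ) - 1 + 1)) (q k - r k)).1 b
        = ((-1) ^ (m - (k : ℕ)) * Q : ℝ) - ((-1) ^ (m - (k : ℕ)) * R : ℝ) := by
      rw [hj, ← hQ, ← hR, map_sub]
      rfl
    have hpow : (-1 : ℝ) ^ (m - (k : ℕ)) = (-1) ^ (m - (k : ℕ) - 1) * -1 := by
      rw [← pow_succ, hj]
    rw [hgj, h4, hrb _ (by omega), hqb _ (by omega), mul_zero, mul_zero, sub_zero, add_zero,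
      ← Complex.ofReal_sub, ← Complex.ofReal_neg, Complex.ofReal_inj, hpow] at h3
    have h5 : (-1 : ℝ) ^ (m - (k : ℕ) - 1) * (Q - R) = (-1) ^ (m - (k : ℕ) - 1) * u := by
      linear_combination h3
    have h6 := mul_left_cancel₀ (pow_ne_zero _ (by norm_num)) h5
    linarith
  · have hg0 := hd.eq_zero hgE (i := k) (j := 0) (by omega) hga (vanishesTo_zero _ _)
    rw [hg0, map_zero] at hgk
    exact hv.ne (Complex.ofReal_inj.1 hgk)

/-! ### The Bernstein operator -/

theorem prod_filter_castSucc_lt_succ {m : ℕ} (f : Fin (m + 1) → ℝ) (k : Fin (m + 1)) :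
    ∏ l : Fin (m + 1) with l.castSucc < k.succ, f l
      = f k * ∏ l : Fin (m + 1) with l.castSucc < k.castSucc, f l := by
  rw [← Finset.prod_insert (by simp)]
  refine Finset.prod_congr ?_ fun _ _ => rfl
  ext l
  simp only [Finset.mem_filter, Finset.mem_univ, true_and, Finset.mem_insert, Fin.lt_def,
    Fin.ext_iff, Fin.val_succ, Fin.val_castSucc]
  omega

theorem prod_filter_castSucc_lt_zero {m : ℕ} (f : Fin (m + 1) → ℝ) :
    ∏ l : Fin (m + 1) with l.castSucc < 0, f l = 1 := by
  simp

/-- Values of two exponentials with common positive weight determine the node and the weight. -/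
theorem node_weight_unique {l₀ l₁ t t' α α' : ℝ} (hl : l₀ < l₁) (hα : 0 < α)
    (h0 : α' * Real.exp (l₀ * t') = α * Real.exp (l₀ * t))
    (h1 : α' * Real.exp (l₁ * t') = α * Real.exp (l₁ * t)) : t' = t ∧ α' = α := by
  have hα' : α' ≠ 0 := by
    rintro rfl
    rw [zero_mul] at h0
    exact (mul_pos hα (Real.exp_pos _)).ne h0
  -- Cross-multiplying the two equations puts the same weight factor on both sides, leaving an
  -- equation for the nodes alone.
  have h2 : α' * α * Real.exp (l₁ * t' + l₀ * t) = α' * α * Real.exp (l₁ * t + l₀ * t') := by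
    rw [Real.exp_add, Real.exp_add]
    linear_combination α * Real.exp (l₀ * t) * h1 - α * Real.exp (l₁ * t) * h0
  have h3 := Real.exp_injective (mul_left_cancel₀ (mul_ne_zero hα' hα.ne') h2)
  have ht : t' = t := by
    have h4 : (l₁ - l₀) * (t' - t) = 0 := by linear_combination h3
    exact sub_eq_zero.1 ((mul_eq_zero.1 h4).resolve_left (sub_pos.2 hl).ne')
  refine ⟨ht, ?_⟩
  rw [ht] at h0
  exact mul_right_cancel₀ (Real.exp_pos _).ne' h0

theorem smoothFun.cexp_ofReal (l : ℝ) : (cexp (l : ℂ)).1 = expFun l := by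
  funext x
  change Complex.exp (l * x) = (Real.exp (l * x) : ℝ)
  push_cast
  rfl

/-- The eigenvalues are `lam 0, …, lam n` with `n = m + 1 ≥ 1`; `Fin.removeNth 0 lam` is
`(lam 1, …, lam n)` and `Fin.removeNth 1 lam` is `(lam 0, lam 2, …, lam n)`. The condition
`(b - a) * M < π` is `b - a < π / M`, with `π / 0 = ∞`. -/
theorem theorem3p1 (m : ℕ) (lam : Fin (m + 2) → ℂ) (l₀ l₁ a b : ℝ)
    (h₀ : lam 0 = (l₀ : ℂ)) (h₁ : lam 1 = (l₁ : ℂ)) (hlt : l₀ < l₁)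
    (hconj : ClosedUnderConj (expPoly lam))
    (hab : 0 < b - a) (hM : (b - a) * maxAbsIm lam < Real.pi) :
    -- the three Bernstein bases exist and are unique
    (∃! p, IsBernsteinBasis lam a b p) ∧
    (∃! p, IsBernsteinBasis (n := m) (Fin.removeNth 0 lam) a b p) ∧
    (∃! p, IsBernsteinBasis (n := m) (Fin.removeNth 1 lam) a b p) ∧
    ∃ t α : Fin (m + 2) → ℝ,
      -- the inductive definition of the nodes
      (t 0 = a ∧ ∀ k : Fin (m + 1),
        Filter.Tendsto
          (fun x => bernsteinBasis (n := m) (Fin.removeNth 1 lam) a b k x /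
            bernsteinBasis (n := m) (Fin.removeNth 0 lam) a b k x)
          (nhdsWithin b {b}ᶜ)
          (nhds ((Real.exp ((l₀ - l₁) * (t k.succ - t k.castSucc)) : ℝ) : ℂ))) ∧
      StrictMono t ∧ t (Fin.last (m + 1)) = b ∧
      -- the definition of the weights
      α 0 = 1 ∧
      (∃ d : Fin (m + 1) → ℝ,
        (∀ l : Fin (m + 1),
          Filter.Tendsto
            (fun x => deriv (bernsteinBasis lam a b l.castSucc) x /
              bernsteinBasis (n := m) (Fin.removeNth 0 lam) a b l x)
            (nhdsWithin b {b}ᶜ) (nhds (d l : ℂ))) ∧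
        ∀ k : Fin (m + 2), k ≠ 0 →
          α k = Real.exp (-l₀ * (t k - a)) * (-1) ^ (k : ℕ) *
            ∏ l : Fin (m + 1) with l.castSucc < k, d l) ∧
      (∀ k, 0 < α k) ∧
      -- the operator fixes the two exponentials
      bernsteinOp lam a b t α (expFun l₀) = expFun l₀ ∧
      bernsteinOp lam a b t α (expFun l₁) = expFun l₁ ∧
      -- uniqueness among all real nodes and weights
      ∀ t' α' : Fin (m + 2) → ℝ,
        (∀ x ∈ Set.Icc a b, bernsteinOp lam a b t' α' (expFun l₀) x = expFun l₀ x) →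
        (∀ x ∈ Set.Icc a b, bernsteinOp lam a b t' α' (expFun l₁) x = expFun l₁ x) →
        t' = t ∧ α' = α := by
  have hd : IsDisconjugate lam a b :=
    { lt := sub_pos.1 hab
      map_conj := map_conj_charPoly hconj
      width := fun i => lt_of_le_of_lt (mul_le_mul_of_nonneg_left
        (Finset.le_sup' (fun j => |(lam j).im|) (Finset.mem_univ i)) hab.le) hM }
  have hd0 := hd.removeNth 0 (by rw [h₀, Complex.conj_ofReal])
  have hd1 := hd.removeNth 1 (by rw [h₁, Complex.conj_ofReal])
  refine ⟨hd.existsUnique_bernsteinBasis, hd0.existsUnique_bernsteinBasis,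
    hd1.existsUnique_bernsteinBasis, ?_⟩
  obtain ⟨p, hp, hpB⟩ := hd.bernsteinBasis_eq
  obtain ⟨q, hq, hqB⟩ := IsDisconjugate.bernsteinBasis_eq (n := m) hd0
  obtain ⟨r, hr, hrB⟩ := IsDisconjugate.bernsteinBasis_eq (n := m) hd1
  rw [hqB, hrB]
  choose P hP hPb using hp.end_sign hd
  choose Q hQ hQb using hq.end_sign hd0
  choose R hR hRb using hr.end_sign hd1
  have hRQ : ∀ k, R k < Q k := fun k =>
    IsSmoothBernstein.end_lt h₀ h₁ hlt hd hp hq hr k (hQb k) (hRb k)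
  have hl : 0 < l₁ - l₀ := sub_pos.2 hlt
  -- the ratios that define the nodes and the weights
  set X : Fin (m + 2) → ℝ := fun k => ∏ l : Fin (m + 1) with l.castSucc < k, Q l / R l with hX
  set Y : Fin (m + 2) → ℝ := fun k => ∏ l : Fin (m + 1) with l.castSucc < k, P l.castSucc / Q l
    with hY
  have hX0 : X 0 = 1 := prod_filter_castSucc_lt_zero _
  have hY0 : Y 0 = 1 := prod_filter_castSucc_lt_zero _
  have hXs : ∀ k : Fin (m + 1), X k.succ = Q k / R k * X k.castSucc :=
    prod_filter_castSucc_lt_succ _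
  have hYs : ∀ k : Fin (m + 1), Y k.succ = P k.castSucc / Q k * Y k.castSucc :=
    prod_filter_castSucc_lt_succ _
  have hXpos : ∀ k, 0 < X k := fun k => Finset.prod_pos fun l _ => div_pos (hQ l) (hR l)
  have hYpos : ∀ k, 0 < Y k := fun k => Finset.prod_pos fun l _ => div_pos (hP _) (hQ l)
  -- Here e^{l₀a} Y_k and e^{l₁a} X_k Y_k are the coefficients of the two exponentials. Their
  -- quotient must be e^{(l₁-l₀)t_k}, which fixes the node; the first coefficient then fixes the
  -- weight.
  set t : Fin (m + 2) → ℝ := fun k => a + Real.log (X k) / (l₁ - l₀) with ht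
  set α : Fin (m + 2) → ℝ := fun k => Real.exp (-l₀ * (t k - a)) * Y k with hα
  have ht0 : t 0 = a := by simp [ht, hX0]
  have hts : ∀ k : Fin (m + 1),
      (l₁ - l₀) * (t k.succ - t k.castSucc) = Real.log (Q k / R k) := by
    intro k
    simp only [ht]
    rw [hXs, Real.log_mul (div_pos (hQ k) (hR k)).ne' (hXpos _).ne']
    field_simp
    ring
  have hαpos : ∀ k, 0 < α k := fun k => mul_pos (Real.exp_pos _) (hYpos k)
  have hα0 : ∀ k, α k * Real.exp (l₀ * t k) = Real.exp (l₀ * a) * Y k := by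
    intro k
    simp only [hα]
    rw [mul_right_comm, ← Real.exp_add]
    ring_nf
  have hα1 : ∀ k, α k * Real.exp (l₁ * t k) = Real.exp (l₁ * a) * (X k * Y k) := by
    intro k
    have h1 : Real.exp ((l₁ - l₀) * (t k - a)) = X k := by
      have h2 : (l₁ - l₀) * (t k - a) = Real.log (X k) := by
        simp only [ht]
        field_simp
        ring
      rw [h2, Real.exp_log (hXpos k)]
    rw [← h1, ← mul_assoc, ← Real.exp_add]
    simp only [hα]
    rw [mul_right_comm, ← Real.exp_add]
    ring_nf
  have hsgn : ∀ k : Fin (m + 1),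
      (-1 : ℝ) ^ (m + 1 - (k : ℕ)) = -(-1) ^ (m - (k : ℕ)) := by
    intro k
    rw [show m + 1 - (k : ℕ) = m - k + 1 by omega, pow_succ]
    ring
  have hop : ∀ (s w : Fin (m + 2) → ℝ) (l x : ℝ), bernsteinOp lam a b s w (expFun l) x
      = ∑ k, ((w k * Real.exp (l * s k) : ℝ) : ℂ) * (p k).1 x := by
    intro s w l x
    simp only [bernsteinOp, hpB, expFun, Complex.ofReal_mul]
  have hfix0 : ∀ x, bernsteinOp lam a b t α (expFun l₀) x = expFun l₀ x := by
    intro x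
    have h1 := hp.sum_eq_cexp (i := 0) hd0 hq (c := fun k => ((-(P k.castSucc / Q k) : ℝ) : ℂ))
      (β := fun k => ((α k * Real.exp (l₀ * t k) : ℝ) : ℂ)) (fun k => ?_) ?_ (fun k => ?_)
    · rw [hop, ← cexp_ofReal, ← h₀, ← h1, smoothFun.sum_apply]
      rfl
    · have h2 := hPb k.castSucc
      rw [Fin.val_castSucc] at h2
      rw [h2, hQb, ← Complex.ofReal_mul, hsgn]
      congr 1
      have := (hQ k).ne'
      field_simp
    · rw [hα0, hY0, mul_one, h₀]
      push_cast
      rfl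
    · rw [hα0, hα0, hYs, ← Complex.ofReal_neg, ← Complex.ofReal_mul]
      congr 1
      ring
  have hfix1 : ∀ x, bernsteinOp lam a b t α (expFun l₁) x = expFun l₁ x := by
    intro x
    have h1 := hp.sum_eq_cexp (i := 1) hd1 hr (c := fun k => ((-(P k.castSucc / R k) : ℝ) : ℂ))
      (β := fun k => ((α k * Real.exp (l₁ * t k) : ℝ) : ℂ)) (fun k => ?_) ?_ (fun k => ?_)
    · rw [hop, ← cexp_ofReal, ← h₁, ← h1, smoothFun.sum_apply]
      rfl
    · have h2 := hPb k.castSucc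
      rw [Fin.val_castSucc] at h2
      rw [h2, hRb, ← Complex.ofReal_mul, hsgn]
      congr 1
      have := (hR k).ne'
      field_simp
    · rw [hα1, hY0, hX0, mul_one, mul_one, h₁]
      push_cast
      rfl
    · rw [hα1, hα1, hYs, hXs, ← Complex.ofReal_neg, ← Complex.ofReal_mul]
      congr 1
      have h3 := (hR k).ne'
      have h4 := (hQ k).ne'
      field_simp
  -- At `b` only the last basis function is nonzero, with value P. So node `b` with weight 1 and the
  -- last node with weight αP give equal values on both exponentials, and `node_weight_unique`
  -- identifies the nodes.
  have hb : ∀ l : ℝ, (∀ x, bernsteinOp lam a b t α (expFun l) x = expFun l x) →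
      1 * Real.exp (l * b) = α (Fin.last _) * P (Fin.last _) * Real.exp (l * t (Fin.last _)) := by
    intro l hl
    have h1 := hl b
    rw [hop, Finset.sum_eq_single_of_mem (Fin.last (m + 1)) (Finset.mem_univ _)] at h1
    · have h2 := hPb (Fin.last (m + 1))
      rw [Fin.val_last, Nat.sub_self, pow_zero, pow_zero, one_mul, Module.End.one_apply] at h2
      rw [h2, ← Complex.ofReal_mul] at h1
      have h3 := Complex.ofReal_inj.1 h1
      linear_combination -h3
    · intro k _ hk
      have h2 : (p k).1 b = 0 := (hp k).2.2.2 0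
        (by have := Fin.val_lt_last hk; omega)
      rw [h2, mul_zero]
  refine ⟨t, α, ⟨ht0, fun k => ?_⟩, ?_, ?_, ?_, ⟨fun k => -(P k.castSucc / Q k), fun l => ?_, ?_⟩,
    hαpos, funext hfix0, funext hfix1, ?_⟩
  · have h1 := (hr k).2.2.2.tendsto_div (hq k).2.2.2
      (by rw [hQb]; exact Complex.ofReal_ne_zero.2 (mul_ne_zero (by simp) (hQ k).ne'))
    rw [hQb, hRb, ← Complex.ofReal_div, mul_div_mul_left _ _ (by simp)] at h1
    have h2 : Real.exp ((l₀ - l₁) * (t k.succ - t k.castSucc)) = R k / Q k := by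
      rw [← neg_sub l₁ l₀, neg_mul, hts, ← Real.log_inv, inv_div,
        Real.exp_log (div_pos (hR k) (hQ k))]
    rw [h2]
    exact h1
  · rw [Fin.strictMono_iff_lt_succ]
    intro k
    have h1 : 0 < (l₁ - l₀) * (t k.succ - t k.castSucc) := by
      rw [hts]
      exact Real.log_pos ((one_lt_div (hR k)).2 (hRQ k))
    exact sub_pos.1 ((mul_pos_iff_of_pos_left hl).1 h1)
  · exact (node_weight_unique hlt (mul_pos (hαpos _) (hP _)) (hb l₀ hfix0) (hb l₁ hfix1)).1.symm
  · simp [hα, ht0, hY0]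
  · rw [hpB]
    -- Differentiation lowers the order at `b` from m + 1 - l to m - l, the order of q_l, so the
    -- limit is the quotient of leading derivatives. Its sign is negative, which the factor (-1)^k
    -- in the weights cancels.
    have h1 := (hp l.castSucc).2.2.2.deriv
    rw [Fin.val_castSucc, show m + 1 - (l : ℕ) - 1 = m - l by omega] at h1
    have h2 := h1.tendsto_div (hq l).2.2.2
      (by rw [hQb]; exact Complex.ofReal_ne_zero.2 (mul_ne_zero (by simp) (hQ l).ne'))
    have h3 := hPb l.castSucc
    rw [Fin.val_castSucc] at h3
    rw [← D_pow_succ_apply, show m - (l : ℕ) + 1 = m + 1 - l by omega, h3, hQb,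
      ← Complex.ofReal_div, hsgn, neg_mul, neg_div, mul_div_mul_left _ _ (by simp)] at h2
    exact h2
  · have h1 : ∀ k : Fin (m + 2), (-1 : ℝ) ^ (k : ℕ) *
        ∏ l : Fin (m + 1) with l.castSucc < k, -(P l.castSucc / Q l) = Y k := by
      intro k
      induction k using Fin.induction with
      | zero => rw [prod_filter_castSucc_lt_zero, hY0]; simp
      | succ k ih =>
        rw [prod_filter_castSucc_lt_succ, hYs, ← ih, Fin.val_succ, Fin.val_castSucc, pow_succ]
        ring
    intro k _
    rw [mul_assoc, h1]
  · intro t' α' h0' h1'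
    -- Both families expand the same exponential in the basis `p`, so the coefficients agree.
    have hu : ∀ l, (∀ x ∈ Set.Icc a b, bernsteinOp lam a b t' α' (expFun l) x = expFun l x) →
        (∀ x, bernsteinOp lam a b t α (expFun l) x = expFun l x) →
        ∀ k, α' k * Real.exp (l * t' k) = α k * Real.exp (l * t k) := by
      intro l hl' hl k
      have h1 := hp.coeff_eq hd.lt (β := fun k => ((α' k * Real.exp (l * t' k) : ℝ) : ℂ))
        (γ := fun k => ((α k * Real.exp (l * t k) : ℝ) : ℂ)) fun x hx => by
          rw [← hop, ← hop, hl' x hx, hl x]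
      exact Complex.ofReal_inj.1 (congrFun h1 k)
    have hk := fun k => node_weight_unique hlt (hαpos k) (hu l₀ h0' hfix0 k) (hu l₁ h1' hfix1 k)
    exact ⟨funext fun k => (hk k).1, funext fun k => (hk k).2⟩
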